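/- **Theorem 4.** Let $z\in\{1,2\}$ and $\rho_1,\rho_2\in(-1,1)$, with $\rho_1^2<\rho_2$ if $z=1$. For $k\ge 1$ let $\Sigma_{\rho_2}^{[k,1]}$ be the $k\times k$ matrix with diagonal entries $1$ and off-diagonal entries $\rho_2$, and let $\Sigma_{\rho_2}^{[k,2]}=(\rho_2^{|i-j|})_{i,j}$ (with $1$ on the diagonal). Let $$\Sigma_{\rho_1,\rho_2}^{[k,z]}=\begin{pmatrix}1&\rho_1\mathbf 1_k^{\mathrm T}\\ \rho_1\mathbf 1_k&\Sigma_{\rho_2}^{[k,z]}\end{pmatrix},\qquad \Sigma_{\rho_1,\rho_2}^{[0,z]}=1 .$$ Let $\nu>0$. Let $\phi_\nu,\Phi_\nu$ be the density and distribution function of Student's $t$-distribution with $\nu$ degrees of freedom, with $\Phi_\nu(-\infty)=0$, $\Phi_\nu(+\infty)=1$, $\Phi_\nu^{-1}(0)=-\infty$, $\Phi_\nu^{-1}(1)=+\infty$. For a positive definite $d\times d$ matrix $\Sigma$ let $\mathrm{MVT}(0,\Sigma,\nu)$ be the distribution on $\mathbb R^d$ with density $$t_{\nu,\Sigma}(x)=\frac{\Gamma(\frac{d+\nu}{2})}{\Gamma(\frac{\nu}{2})(\pi\nu)^{d/2}|\Sigma|^{1/2}}\Bigl(1+\tfrac1\nu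 x^{\mathrm T}\Sigma^{-1}x\Bigr)^{-(d+\nu)/2},$$ let the t-copula $C_{\nu,\Sigma}(u)$ be its distribution function at $(\Phi_\nu^{-1}(u_1),\dots,\Phi_\nu^{-1}(u_d))$, and let $c_{\nu,\Sigma}(u)=t_{\nu,\Sigma}(\Phi_\nu^{-1}(u_1),\dots,\Phi_\nu^{-1}(u_d))/\prod_i\phi_\nu(\Phi_\nu^{-1}(u_i))$ be the density of $C_{\nu,\Sigma}$. Let $N^+$ be a positive integer-valued random variable with distribution function $F_1^+$, and let $Y_1,Y_2,\dots$ be real random variables such that, for every $k\ge1$ for which $\Sigma_{\rho_1,\rho_2}^{[k,z]}$ is positive definite, $(N^+,Y_1,\dots,Y_k)$ has joint distribution function $C_{\nu,\Sigma_{\rho_1,\rho_2}^{[k,z]}}(F_1^+,F_2,\dots,F_2)$, where $F_2$ is a distribution function on $[0,\infty)$ with density $f_2$. Let $R$ be a Bernoulli variable with success probability $p\in[0,1]$, independent of $(N^+,Y_1,\dots,Y_k)$ for every $k\ge1$. Put $N=N^+$ if $R=1$ and $N=0$ if $R=0$, and $\boldsymbol Y^{[N]}=(Y_1,\dots,Y_N)$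 (the single point of $\mathbb R^0$ if $N=0$). Define $h(0)=1-p$ and, for $n\ge1$ and $\boldsymbol y=(y_1,\dots,y_n)\in\mathbb R^n$, $$h(n,\boldsymbol y)=p\,f^*_n(\boldsymbol y)\left(\Phi_{\nu+n}\!\left(\frac{\Phi_\nu^{-1}(F_1^+(n))-\mu^*_n}{\sigma^*_n}\right)-\Phi_{\nu+n}\!\left(\frac{\Phi_\nu^{-1}(F_1^+(n-1))-\mu^*_n}{\sigma^*_n}\right)\right),$$ where, with $\Sigma=\Sigma_{\rho_2}^{[n,z]}$ and $w=(\Phi_\nu^{-1}(F_2(y_1)),\dots,\Phi_\nu^{-1}(F_2(y_n)))^{\mathrm T}$, $$f^*_n(\boldsymbol y)=c_{\nu,\Sigma}(F_2(y_1),\dots,F_2(y_n))\prod_{i=1}^n f_2(y_i),\qquad \mu^*_n=\rho_1\mathbf 1_n^{\mathrm T}\Sigma^{-1}w,$$ $$\sigma^*_n=\sqrt{1-\rho_1^2\,\mathbf 1_n^{\mathrm T}\Sigma^{-1}\mathbf 1_n}\;\sqrt{\frac{\nu+w^{\mathrm T}\Sigma^{-1}w}{\nu+n}} .$$ Then $h$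 is the joint density of $(N,\boldsymbol Y^{[N]})$: for every $n\ge0$ and every Borel set $A\subseteq\mathbb R^n$, $$P\bigl(N=n,\ (Y_1,\dots,Y_n)\in A\bigr)=\int_A h(n,\boldsymbol y)\,d\boldsymbol y ,$$ where for $n=0$ the integral is with respect to the unit mass on $\mathbb R^0$; if $z=2$, this holds for every $n$ for which $\Sigma_{\rho_1,\rho_2}^{[n,2]}$ is positive definite. Consequently the law of $(N,\boldsymbol Y^{[N]})$ on the disjoint union $\bigsqcup_{n\ge0}\mathbb R^n$ has density $h$ with respect to the sum of the Lebesgue measures, provided, if $z=2$, that $\Sigma_{\rho_1,\rho_2}^{[n,2]}$ is positive definite for every $n$ with $P(N^+=n)>0$. -/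

import Mathlib

open MeasureTheory ProbabilityTheory Set
open scoped ENNReal Matrix

noncomputable section

namespace CollectiveRisk

/-- The two correlation structures for the severities: equicorrelation (`z = 1`) and
autoregressive (`z = 2`). -/
inductive CorrType where
  | equi
  | autoreg

/-- The `k × k` severity correlation matrix `Σ_{ρ₂}^{[k,z]}`. -/
def sevCorr (z : CorrType) (ρ₂ : ℝ) (k : ℕ) : Matrix (Fin k) (Fin k) ℝ :=
  match z with
  | .equi => Matrix.of fun i j => if i = j then 1 else ρ₂
  | .autoreg => Matrix.of fun i j => if i = j then 1 else ρ₂ ^ ((i : ℤ) - (j : ℤ)).natAbs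

/-- The `(k+1) × (k+1)` correlation matrix `Σ_{ρ₁,ρ₂}^{[k,z]}` of frequency and severities.
The index `Sum.inl ()` is the frequency, `Sum.inr j` is the severity number `j + 1`. -/
def jointCorr (z : CorrType) (ρ₁ ρ₂ : ℝ) (k : ℕ) : Matrix (Unit ⊕ Fin k) (Unit ⊕ Fin k) ℝ :=
  Matrix.fromBlocks (Matrix.of fun _ _ => 1) (Matrix.of fun _ _ => ρ₁)
    (Matrix.of fun _ _ => ρ₁) (sevCorr z ρ₂ k)

/-- The range of the correlation parameters: `ρ₁, ρ₂ ∈ (-1,1)`, and moreover `ρ₁² < ρ₂` for the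
equicorrelation structure. -/
def ParamRange (z : CorrType) (ρ₁ ρ₂ : ℝ) : Prop :=
  ρ₁ ∈ Ioo (-1 : ℝ) 1 ∧ ρ₂ ∈ Ioo (-1 : ℝ) 1 ∧
    match z with
    | .equi => ρ₁ ^ 2 < ρ₂
    | .autoreg => True

/-- The density `φ_ν` of the univariate Student distribution with `ν` degrees of freedom. -/
def studentPDF (ν x : ℝ) : ℝ :=
  Real.Gamma ((ν + 1) / 2) / (Real.Gamma (ν / 2) * Real.sqrt (Real.pi * ν)) *
    (1 + x ^ 2 / ν) ^ (-(ν + 1) / 2)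

/-- The distribution function `Φ_ν` of the univariate Student distribution, on the extended real
line (so that it is `0` at `-∞` and `1` at `+∞`). -/
def studentCDF (ν : ℝ) (x : EReal) : ℝ :=
  ∫ t in {t : ℝ | (t : EReal) ≤ x}, studentPDF ν t

/-- The quantile function `Φ_ν⁻¹ : [0,1] → [-∞,∞]` of the univariate Student distribution
(`-∞` at `0` and `+∞` at `1`). -/
def studentQuantile (ν u : ℝ) : EReal :=
  sInf {x : EReal | u ≤ studentCDF ν x}

variable {ι : Type*} [Fintype ι] [DecidableEq ι]

/-- The density of the multivariate t-distribution `MVT(0, S, ν)` on `ℝ^ι`. -/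
def mvtPDF (ν : ℝ) (S : Matrix ι ι ℝ) (x : ι → ℝ) : ℝ :=
  Real.Gamma ((Fintype.card ι + ν) / 2) /
      (Real.Gamma (ν / 2) * (Real.pi * ν) ^ ((Fintype.card ι : ℝ) / 2) * Real.sqrt S.det) *
    (1 + (x ⬝ᵥ (S⁻¹ *ᵥ x)) / ν) ^ (-(Fintype.card ι + ν) / 2)

/-- The multivariate t-distribution `MVT(0, S, ν)`. -/
def mvt (ν : ℝ) (S : Matrix ι ι ℝ) : Measure (ι → ℝ) :=
  volume.withDensity fun x => ENNReal.ofReal (mvtPDF ν S x)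

/-- The t-copula `C_{ν,S}`: the joint distribution function of `MVT(0, S, ν)` at the point
`(Φ_ν⁻¹(u_i))_i`. -/
def tCopula (ν : ℝ) (S : Matrix ι ι ℝ) (u : ι → ℝ) : ℝ≥0∞ :=
  mvt ν S {x | ∀ i, (x i : EReal) ≤ studentQuantile ν (u i)}

/-- The density `c_{ν,S}` of the t-copula on the open unit cube. -/
def tCopulaPDF (ν : ℝ) (S : Matrix ι ι ℝ) (u : ι → ℝ) : ℝ :=
  mvtPDF ν S (fun i => (studentQuantile ν (u i)).toReal) /
    ∏ i, studentPDF ν (studentQuantile ν (u i)).toReal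

/-- `f` is a probability density of a distribution on the nonnegative reals. -/
structure IsSeverityDensity (f : ℝ → ℝ) : Prop where
  measurable : Measurable f
  nonneg : ∀ y, 0 ≤ f y
  eq_zero : ∀ y < 0, f y = 0
  lintegral_eq_one : ∫⁻ y, ENNReal.ofReal (f y) = 1

/-- The distribution function `F₂` with density `f₂`. -/
def severityCDF (f₂ : ℝ → ℝ) (y : ℝ) : ℝ := ∫ t in Iic y, f₂ t

/-- The scores `(Φ_ν⁻¹(F₂(y_1)), …, Φ_ν⁻¹(F₂(y_k)))`. -/
def scores (ν : ℝ) (f₂ : ℝ → ℝ) {k : ℕ} (y : Fin k → ℝ) : Fin k → ℝ :=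
  fun j => (studentQuantile ν (severityCDF f₂ (y j))).toReal

/-- The density `f*_{Y^{[k]}}(y) = c_{ν,Σ}(F₂(y_1), …, F₂(y_k)) ∏ f₂(y_i)`, `Σ = Σ_{ρ₂}^{[k,z]}`. -/
def sevDensity (z : CorrType) (ν ρ₂ : ℝ) (f₂ : ℝ → ℝ) {k : ℕ} (y : Fin k → ℝ) : ℝ :=
  tCopulaPDF ν (sevCorr z ρ₂ k) (fun j => severityCDF f₂ (y j)) * ∏ j, f₂ (y j)

/-- `μ*_{[k,z]} = (ρ₁ 1ᵀ) Σ⁻¹ (scores)`. -/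
def muStar (z : CorrType) (ν ρ₁ ρ₂ : ℝ) (f₂ : ℝ → ℝ) {k : ℕ} (y : Fin k → ℝ) : ℝ :=
  (fun _ : Fin k => ρ₁) ⬝ᵥ ((sevCorr z ρ₂ k)⁻¹ *ᵥ scores ν f₂ y)

/-- `σ_{[k,z]} = √(1 - (ρ₁ 1ᵀ) Σ⁻¹ (ρ₁ 1))`. -/
def sigma (z : CorrType) (ρ₁ ρ₂ : ℝ) (k : ℕ) : ℝ :=
  Real.sqrt (1 - (fun _ : Fin k => ρ₁) ⬝ᵥ ((sevCorr z ρ₂ k)⁻¹ *ᵥ fun _ : Fin k => ρ₁))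

/-- `σ*_{[k,z]} = σ_{[k,z]} √((ν + (scores)ᵀ Σ⁻¹ (scores)) / (ν + k))`. -/
def sigmaStar (z : CorrType) (ν ρ₁ ρ₂ : ℝ) (f₂ : ℝ → ℝ) {k : ℕ} (y : Fin k → ℝ) : ℝ :=
  sigma z ρ₁ ρ₂ k *
    Real.sqrt ((ν + scores ν f₂ y ⬝ᵥ ((sevCorr z ρ₂ k)⁻¹ *ᵥ scores ν f₂ y)) / (ν + k))

variable {Ω : Type*} [MeasurableSpace Ω]

/-- The distribution function `F₁⁺` of the positive frequency, at nonnegative integers. -/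
def freqCDF (P : Measure Ω) (Nplus : Ω → ℕ) (n : ℕ) : ℝ :=
  P.real {ω | Nplus ω ≤ n}

/-- The t-copula conditional model. `Y j` is the severity number `j + 1`. The joint distribution
function of `(N⁺, Y_1, …, Y_k)` is `C_{ν,Σ}(F₁⁺, F₂, …, F₂)` with `Σ = Σ_{ρ₁,ρ₂}^{[k,z]}`, for every
positive `k` for which this t-copula exists, that is, for which `Σ` is positive definite. -/
structure TCopulaModel (P : Measure Ω) (z : CorrType) (ν ρ₁ ρ₂ : ℝ) (f₂ : ℝ → ℝ)
    (Nplus : Ω → ℕ) (Y : ℕ → Ω → ℝ) : Prop where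
  df_pos : 0 < ν
  params : ParamRange z ρ₁ ρ₂
  severity : IsSeverityDensity f₂
  measurable_freq : Measurable Nplus
  freq_pos : ∀ ω, 0 < Nplus ω
  measurable_sev : ∀ j, Measurable (Y j)
  joint_cdf : ∀ k : ℕ, 0 < k → (jointCorr z ρ₁ ρ₂ k).PosDef → ∀ (n : ℕ) (y : Fin k → ℝ),
    P {ω | Nplus ω ≤ n ∧ ∀ j : Fin k, Y j ω ≤ y j} =
      tCopula ν (jointCorr z ρ₁ ρ₂ k)
        (Sum.elim (fun _ => freqCDF P Nplus n) fun j => severityCDF f₂ (y j))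

/-- `R` is Bernoulli with success probability `p`, independent of `(N⁺, Y_1, …, Y_k)` for every
positive `k`. -/
structure IsZeroIndicator (P : Measure Ω) (p : ℝ) (R : Ω → Bool) (Nplus : Ω → ℕ)
    (Y : ℕ → Ω → ℝ) : Prop where
  prob_mem : p ∈ Icc (0 : ℝ) 1
  measurable : Measurable R
  prob_true : P {ω | R ω = true} = ENNReal.ofReal p
  indep : ∀ k : ℕ, 0 < k → IndepFun R (fun ω => (Nplus ω, fun j : Fin k => Y j ω)) P

/-- The frequency `N`: equal to `N⁺` if `R = 1` and to `0` if `R = 0`. -/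
def freq (R : Ω → Bool) (Nplus : Ω → ℕ) (ω : Ω) : ℕ := if R ω then Nplus ω else 0

/-- The observation `(N, Y^{[N]})`, with values in the disjoint union of the `ℝ^n`, `n ≥ 0`
(where `ℝ^0` is a single point). -/
def observation (R : Ω → Bool) (Nplus : Ω → ℕ) (Y : ℕ → Ω → ℝ) (ω : Ω) : Σ n : ℕ, Fin n → ℝ :=
  ⟨freq R Nplus ω, fun j => Y j ω⟩

/-- The reference measure on the disjoint union of the `ℝ^n`: Lebesgue measure on each `ℝ^n`, and
the unit mass on `ℝ^0`. -/
def refMeasure : Measure (Σ n : ℕ, Fin n → ℝ) :=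
  Measure.sum fun n : ℕ => (volume : Measure (Fin n → ℝ)).map (Sigma.mk n)

/-- The mixed density `h_{N⁺,Y^{[k]}}(n, y)` of the t-copula conditional model, for `n ≥ 1`. -/
def condDensity (P : Measure Ω) (z : CorrType) (ν ρ₁ ρ₂ : ℝ) (f₂ : ℝ → ℝ) (Nplus : Ω → ℕ)
    {k : ℕ} (n : ℕ) (y : Fin k → ℝ) : ℝ :=
  sevDensity z ν ρ₂ f₂ y *
    (studentCDF (ν + k)
        ((studentQuantile ν (freqCDF P Nplus n) - (muStar z ν ρ₁ ρ₂ f₂ y : EReal)) /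
          (sigmaStar z ν ρ₁ ρ₂ f₂ y : EReal)) -
      studentCDF (ν + k)
        ((studentQuantile ν (freqCDF P Nplus (n - 1)) - (muStar z ν ρ₁ ρ₂ f₂ y : EReal)) /
          (sigmaStar z ν ρ₁ ρ₂ f₂ y : EReal)))

/-- The function `h(n, y^{[n]})`: `1 - p` for `n = 0`, and `p` times the mixed density of the
conditional model with `k = n` for `n ≥ 1`. -/
def riskDensity (P : Measure Ω) (z : CorrType) (ν ρ₁ ρ₂ : ℝ) (f₂ : ℝ → ℝ) (Nplus : Ω → ℕ)
    (p : ℝ) (x : Σ n : ℕ, Fin n → ℝ) : ℝ :=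
  if x.1 = 0 then 1 - p else p * condDensity P z ν ρ₁ ρ₂ f₂ Nplus x.1 x.2

end CollectiveRisk

end

open CollectiveRisk

/-! ### Distribution functions, the uniform law and product measures -/

section Transform

open Filter Topology

/-! Completing the square for the bordered correlation matrix splits its inverse quadratic form into
that of the severity scores plus a squared residual over the Schur complement. Hence the
multivariate t-density factors into the t-density of the severity scores times a Student density
with `ν + k` degrees of freedom, location `μ*` and scale `σ*` (`mvtPDF_borderedMatrix`). Integrating
out the frequency score up to `Φ_ν⁻¹(F₁⁺(n))` leaves a value of `Φ_{ν+k}` (`mvt_borderedMatrix`).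

Scores are then exchanged for severities. `F₂` need be neither injective nor smooth, so no Jacobian
is used: the Student law and the severity law are both carried to the uniform law by their own
distribution functions, and integrals are compared there (`setLIntegral_pi_cdf`,
`setLIntegral_scores`).

This gives a density in `y` for the event `N⁺ ≤ n`, first on orthants and hence on all Borel sets;
the increment from `n - 1` to `n` gives `N⁺ = n` (`measure_freq_eq_inter`). With `k = n`,
independence of `R` supplies the factor `p`, the event `R = 0` the mass `1 - p`, and summation over
`n` the law on the disjoint union. -/

theorem continuous_cdf_of_nullSingletonClass (μ : Measure ℝ) [IsProbabilityMeasure μ]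
    [NullSingletonClass μ] :
    Continuous (cdf μ) := by
  refine continuous_iff_continuousAt.2 fun x => ?_
  rw [(cdf μ).mono.continuousAt_iff_leftLim_eq_rightLim, (cdf μ).rightLim_eq]
  have h := (cdf μ).measure_singleton x
  rw [measure_cdf, measure_singleton, eq_comm, ENNReal.ofReal_eq_zero] at h
  exact le_antisymm ((cdf μ).mono.leftLim_le le_rfl) (by linarith)

/-- For `u < 1` the sublevel set is closed and bounded above, so it lies below its supremum, where
the cdf is still at most `u`. For `0 < u < 1` the intermediate value theorem gives a point with cdf
exactly `u`, hence the reverse bound. -/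
theorem measure_cdf_le (μ : Measure ℝ) [IsProbabilityMeasure μ] [NullSingletonClass μ] (u : ℝ) :
    μ {x | cdf μ x ≤ u} = ENNReal.ofReal (min u 1) := by
  rcases le_or_gt 1 u with hu | hu
  · have : {x | cdf μ x ≤ u} = univ := eq_univ_of_forall fun x => (cdf_le_one μ x).trans hu
    simp [this, hu]
  have hcont := continuous_cdf_of_nullSingletonClass μ
  obtain ⟨z, hz⟩ : ∃ z, u < cdf μ z := ((tendsto_cdf_atTop μ).eventually_const_lt hu).exists
  rw [min_eq_left hu.le]
  apply le_antisymm
  · rcases eq_empty_or_nonempty {x | cdf μ x ≤ u} with h | h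
    · simp [h]
    have hb : BddAbove {x | cdf μ x ≤ u} :=
      ⟨z, fun x hx => le_of_lt ((monotone_cdf μ).reflect_lt (lt_of_le_of_lt hx hz))⟩
    have hc : IsClosed {x | cdf μ x ≤ u} := isClosed_le hcont continuous_const
    calc μ {x | cdf μ x ≤ u} ≤ μ (Iic (sSup {x | cdf μ x ≤ u})) :=
          measure_mono fun x hx => le_csSup hb hx
      _ = ENNReal.ofReal (cdf μ (sSup {x | cdf μ x ≤ u})) := (ofReal_cdf μ _).symm
      _ ≤ ENNReal.ofReal u := ENNReal.ofReal_le_ofReal (hc.csSup_mem h hb)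
  · rcases le_or_gt u 0 with h0 | h0
    · simp [ENNReal.ofReal_of_nonpos h0]
    obtain ⟨w, hw⟩ : ∃ w, cdf μ w < u := ((tendsto_cdf_atBot μ).eventually_lt_const h0).exists
    obtain ⟨y, hy⟩ := mem_range_of_exists_le_of_exists_ge hcont ⟨w, hw.le⟩ ⟨z, hz.le⟩
    rw [← hy, ofReal_cdf]
    exact measure_mono fun x hx => monotone_cdf μ hx

/-- The probability integral transform. -/
theorem map_cdf_eq_uniform (μ : Measure ℝ) [IsProbabilityMeasure μ] [NullSingletonClass μ] :
    μ.map (cdf μ) = volume.restrict (Icc (0 : ℝ) 1) := by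
  have hm : Measurable (cdf μ) := (monotone_cdf μ).measurable
  have := Measure.isProbabilityMeasure_map (μ := μ) hm.aemeasurable
  refine Measure.ext_of_Iic _ _ fun u => ?_
  rw [Measure.map_apply hm measurableSet_Iic, Measure.restrict_apply measurableSet_Iic]
  have : Iic u ∩ Icc (0 : ℝ) 1 = Icc 0 (min u 1) := by
    ext; simp; tauto
  rw [this, Real.volume_Icc, sub_zero, ← measure_cdf_le μ u]
  rfl

/-- The cdf may be flat to the right of `y`, but a flat stretch carries no mass: the sets are nested
and of equal measure. -/
theorem cdf_preimage_Iic_ae_eq (μ : Measure ℝ) [IsProbabilityMeasure μ] [NullSingletonClass μ]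
    (y : ℝ) :
    {x | cdf μ x ≤ cdf μ y} =ᵐ[μ] Iic y := by
  have h1 : Iic y ⊆ {x | cdf μ x ≤ cdf μ y} := fun x hx => monotone_cdf μ hx
  have h2 : μ {x | cdf μ x ≤ cdf μ y} ≤ μ (Iic y) := by
    rw [measure_cdf_le, min_eq_left (cdf_le_one μ y), ofReal_cdf]
  exact (ae_eq_of_subset_of_measure_ge h1 h2 measurableSet_Iic.nullMeasurableSet
    (measure_ne_top _ _)).symm

variable {ι : Type*} [Fintype ι]

theorem pi_withDensity_ofReal {f : ℝ → ℝ} (hf : Integrable f) (h0 : ∀ x, 0 ≤ f x) :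
    Measure.pi (fun _ : ι => volume.withDensity fun x => ENNReal.ofReal (f x)) =
      (volume : Measure (ι → ℝ)).withDensity fun x => ENNReal.ofReal (∏ i, f (x i)) := by
  have : IsFiniteMeasure (volume.withDensity fun x => ENNReal.ofReal (f x)) :=
    isFiniteMeasure_withDensity_ofReal hf.2
  refine (Measure.pi_eq fun s hs => ?_)
  rw [withDensity_apply _ (MeasurableSet.univ_pi hs), volume_pi, Measure.restrict_pi_pi,
    ← ofReal_integral_eq_lintegral_ofReal]
  · rw [integral_fintype_prod_eq_prod (fun _ => f),
      ENNReal.ofReal_prod_of_nonneg fun i _ => integral_nonneg h0]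
    refine Finset.prod_congr rfl fun i _ => ?_
    rw [withDensity_apply _ (hs i), ofReal_integral_eq_lintegral_ofReal hf.integrableOn
      (Eventually.of_forall h0)]
  · exact Integrable.fintype_prod fun i => hf.integrableOn
  · exact Eventually.of_forall fun x => Finset.prod_nonneg fun i _ => h0 _

/-- Lower orthants form a π-system generating the product σ-algebra, and countably many of them
cover the space. -/
theorem measure_pi_ext_of_Iic {μ ν : Measure (ι → ℝ)} [IsFiniteMeasure μ]
    (h : ∀ y : ι → ℝ, μ {x | ∀ i, x i ≤ y i} = ν {x | ∀ i, x i ≤ y i}) : μ = ν := by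
  have hset : ∀ y : ι → ℝ, {x : ι → ℝ | ∀ i, x i ≤ y i} = univ.pi fun i => Iic (y i) := by
    intro y; ext; simp [Pi.le_def]
  have hspan : IsCountablySpanning (range (Iic : ℝ → Set ℝ)) :=
    ⟨fun n => Iic (n : ℝ), fun n => ⟨_, rfl⟩, eq_univ_of_forall fun x =>
      let ⟨n, hn⟩ := exists_nat_ge x; mem_iUnion.2 ⟨n, hn⟩⟩
  refine Measure.ext_of_generateFrom_of_iUnion
    (pi univ '' pi univ fun _ : ι => range (Iic : ℝ → Set ℝ))
    (fun n => univ.pi fun _ => Iic (n : ℝ)) ?_ (IsPiSystem.pi fun _ => isPiSystem_Iic) ?_ ?_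
    (fun n => measure_ne_top _ _) ?_
  · rw [← generateFrom_pi_eq fun _ => hspan]
    congr 1
    funext i
    rw [← borel_eq_generateFrom_Iic]
    exact BorelSpace.measurable_eq
  · refine eq_univ_of_forall fun x => ?_
    obtain ⟨n, hn⟩ := exists_nat_ge (∑ i, |x i|)
    refine mem_iUnion.2 ⟨n, fun i _ => ?_⟩
    exact (le_abs_self _).trans ((Finset.single_le_sum (fun j _ => abs_nonneg (x j))
      (Finset.mem_univ i)).trans hn)
  · exact fun n => ⟨_, fun i _ => ⟨_, rfl⟩, rfl⟩
  · rintro _ ⟨t, ht, rfl⟩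
    choose y hy using fun i => ht i (mem_univ i)
    obtain rfl : (fun i => Iic (y i)) = t := funext hy
    rw [← hset, h]

end Transform
-- The Student distribution on the extended line
section Student

open Filter Topology

theorem studentPDF_pos {ν : ℝ} (hν : 0 < ν) (x : ℝ) : 0 < studentPDF ν x := by
  unfold studentPDF
  positivity

theorem continuous_studentPDF {ν : ℝ} (hν : 0 < ν) : Continuous (studentPDF ν) := by
  unfold studentPDF
  refine continuous_const.mul (Continuous.rpow_const (by fun_prop) fun x => Or.inl ?_)
  positivity

theorem lintegral_rpow_mul_exp_neg_mul_Ioi {a r : ℝ} (ha : 0 < a) (hr : 0 < r) :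
    ∫⁻ t in Ioi (0 : ℝ), ENNReal.ofReal (t ^ (a - 1) * Real.exp (-(r * t))) =
      ENNReal.ofReal ((1 / r) ^ a * Real.Gamma a) := by
  have h := Real.integral_rpow_mul_exp_neg_mul_Ioi ha hr
  have hpos : 0 < (1 / r) ^ a * Real.Gamma a := by positivity
  rw [← h, ofReal_integral_eq_lintegral_ofReal]
  -- The Bochner integral of a non-integrable function is `0`, so its positive value proves
  -- integrability.
  · exact not_imp_comm.1 integral_undef (by rw [h]; exact hpos.ne')
  · filter_upwards [self_mem_ae_restrict measurableSet_Ioi] with t ht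
    have : (0 : ℝ) < t := ht
    positivity

theorem lintegral_gaussian {b : ℝ} (hb : 0 < b) :
    ∫⁻ x : ℝ, ENNReal.ofReal (Real.exp (-b * x ^ 2)) = ENNReal.ofReal √(Real.pi / b) := by
  rw [← integral_gaussian, ofReal_integral_eq_lintegral_ofReal (integrable_exp_neg_mul_sq hb)]
  exact Eventually.of_forall fun x => (Real.exp_pos _).le

/-- The Student density is a Gamma mixture of Gaussians: the power of `1 + x² / ν` is written as a
Gamma integral in `t`, Tonelli brings the Gaussian integral in `x` inside, and its factor `t ^
(-1/2)` lowers the Gamma parameter from `(ν + 1) / 2` to `ν / 2`. -/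
theorem lintegral_one_add_sq_div_rpow {ν : ℝ} (hν : 0 < ν) :
    ∫⁻ x : ℝ, ENNReal.ofReal (Real.Gamma ((ν + 1) / 2) * (1 + x ^ 2 / ν) ^ (-(ν + 1) / 2)) =
      ENNReal.ofReal (√(Real.pi * ν) * Real.Gamma (ν / 2)) := by
  have h1 : ∀ x : ℝ, ENNReal.ofReal
      (Real.Gamma ((ν + 1) / 2) * (1 + x ^ 2 / ν) ^ (-(ν + 1) / 2)) =
      ∫⁻ t in Ioi (0 : ℝ), ENNReal.ofReal
        (t ^ ((ν + 1) / 2 - 1) * Real.exp (-((1 + x ^ 2 / ν) * t))) := by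
    intro x
    have hx : 0 < 1 + x ^ 2 / ν := by positivity
    rw [lintegral_rpow_mul_exp_neg_mul_Ioi (by positivity) hx, mul_comm, one_div,
      Real.inv_rpow hx.le, ← Real.rpow_neg hx.le, neg_div]
  simp_rw [h1]
  rw [lintegral_lintegral_swap (by
    refine Measurable.aemeasurable ?_
    simp only [Function.uncurry_def]
    fun_prop)]
  have h2 : ∀ t ∈ Ioi (0 : ℝ), ∫⁻ x : ℝ, ENNReal.ofReal
      (t ^ ((ν + 1) / 2 - 1) * Real.exp (-((1 + x ^ 2 / ν) * t))) =
      ENNReal.ofReal √(Real.pi * ν) *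
        ENNReal.ofReal (t ^ (ν / 2 - 1) * Real.exp (-(1 * t))) := by
    intro t ht
    have ht : 0 < t := ht
    have : ∀ x : ℝ, ENNReal.ofReal
        (t ^ ((ν + 1) / 2 - 1) * Real.exp (-((1 + x ^ 2 / ν) * t))) =
        ENNReal.ofReal (t ^ ((ν + 1) / 2 - 1) * Real.exp (-(1 * t))) *
          ENNReal.ofReal (Real.exp (-(t / ν) * x ^ 2)) := by
      intro x
      rw [← ENNReal.ofReal_mul (by positivity), mul_assoc, ← Real.exp_add]
      congr 3
      ring
    simp_rw [this]
    rw [lintegral_const_mul _ (by fun_prop), lintegral_gaussian (by positivity),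
      ← ENNReal.ofReal_mul (by positivity), ← ENNReal.ofReal_mul (by positivity)]
    congr 1
    have e1 : Real.pi / (t / ν) = Real.pi * ν / t := by field_simp
    have e2 : t ^ ((ν + 1) / 2 - 1) = t ^ (ν / 2 - 1) * √t := by
      rw [Real.sqrt_eq_rpow, ← Real.rpow_add ht]
      congr 1
      ring
    rw [e1, e2, Real.sqrt_div (by positivity)]
    have : √t ≠ 0 := by positivity
    field_simp
  rw [setLIntegral_congr_fun measurableSet_Ioi h2, lintegral_const_mul _ (by fun_prop),
    lintegral_rpow_mul_exp_neg_mul_Ioi (by positivity) one_pos,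
    ← ENNReal.ofReal_mul (by positivity)]
  simp

theorem lintegral_studentPDF {ν : ℝ} (hν : 0 < ν) :
    ∫⁻ x, ENNReal.ofReal (studentPDF ν x) = 1 := by
  have h : ∀ x, ENNReal.ofReal (studentPDF ν x) =
      ENNReal.ofReal (1 / (Real.Gamma (ν / 2) * √(Real.pi * ν))) * ENNReal.ofReal
        (Real.Gamma ((ν + 1) / 2) * (1 + x ^ 2 / ν) ^ (-(ν + 1) / 2)) := by
    intro x
    rw [← ENNReal.ofReal_mul (by positivity)]
    congr 1
    unfold studentPDF
    ring
  simp_rw [h]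
  rw [lintegral_const_mul _ (by fun_prop), lintegral_one_add_sq_div_rpow hν,
    ← ENNReal.ofReal_mul (by positivity)]
  have : 0 < Real.Gamma (ν / 2) * √(Real.pi * ν) := by positivity
  rw [mul_comm √_, one_div_mul_cancel this.ne', ENNReal.ofReal_one]

/-- The probability measure with a given Lebesgue density. -/
noncomputable abbrev realLaw (f : ℝ → ℝ) : Measure ℝ :=
  volume.withDensity fun x => ENNReal.ofReal (f x)

theorem integrable_of_lintegral_ofReal_eq_one {f : ℝ → ℝ} (hf : Measurable f)
    (h0 : ∀ x, 0 ≤ f x) (h1 : ∫⁻ x, ENNReal.ofReal (f x) = 1) : Integrable f :=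
  (lintegral_ofReal_ne_top_iff_integrable hf.aestronglyMeasurable (Eventually.of_forall h0)).1
    (by rw [h1]; exact ENNReal.one_ne_top)

theorem isProbabilityMeasure_realLaw {f : ℝ → ℝ} (h1 : ∫⁻ x, ENNReal.ofReal (f x) = 1) :
    IsProbabilityMeasure (realLaw f) :=
  ⟨by rw [realLaw, withDensity_apply _ MeasurableSet.univ, Measure.restrict_univ, h1]⟩

theorem cdf_realLaw {f : ℝ → ℝ} (hf : Measurable f) (h0 : ∀ x, 0 ≤ f x)
    (h1 : ∫⁻ x, ENNReal.ofReal (f x) = 1) (x : ℝ) :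
    cdf (realLaw f) x = ∫ t in Iic x, f t := by
  have := isProbabilityMeasure_realLaw h1
  have hi := integrable_of_lintegral_ofReal_eq_one hf h0 h1
  rw [cdf_eq_real, Measure.real, realLaw, withDensity_apply _ measurableSet_Iic,
    ← ofReal_integral_eq_lintegral_ofReal hi.integrableOn (Eventually.of_forall h0),
    ENNReal.toReal_ofReal (integral_nonneg h0)]

theorem integrable_studentPDF {ν : ℝ} (hν : 0 < ν) : Integrable (studentPDF ν) :=
  integrable_of_lintegral_ofReal_eq_one (continuous_studentPDF hν).measurable
    (fun x => (studentPDF_pos hν x).le) (lintegral_studentPDF hν)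

theorem studentCDF_coe {ν : ℝ} (hν : 0 < ν) (x : ℝ) :
    studentCDF ν x = cdf (realLaw (studentPDF ν)) x := by
  rw [cdf_realLaw (continuous_studentPDF hν).measurable (fun x => (studentPDF_pos hν x).le)
    (lintegral_studentPDF hν), studentCDF]
  simp only [EReal.coe_le_coe_iff]
  rfl

theorem studentCDF_bot (ν : ℝ) : studentCDF ν ⊥ = 0 := by
  simp [studentCDF]

theorem studentCDF_top {ν : ℝ} (hν : 0 < ν) : studentCDF ν ⊤ = 1 := by
  simp only [studentCDF, le_top, ofPred_true, Measure.restrict_univ]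
  rw [integral_eq_lintegral_of_nonneg_ae (Eventually.of_forall fun x => (studentPDF_pos hν x).le)
    (continuous_studentPDF hν).aestronglyMeasurable, lintegral_studentPDF hν, ENNReal.toReal_one]

theorem measurableSet_coe_le (x : EReal) : MeasurableSet {t : ℝ | (t : EReal) ≤ x} :=
  measurable_coe_real_ereal measurableSet_Iic

/-- The density is positive everywhere, and between two distinct extended reals there is a real
interval of positive length. -/
theorem strictMono_studentCDF {ν : ℝ} (hν : 0 < ν) : StrictMono (studentCDF ν) := by
  intro x y hxy
  obtain ⟨a, hxa, hay⟩ := EReal.lt_iff_exists_real_btwn.1 hxy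
  obtain ⟨b, hab, hby⟩ := EReal.lt_iff_exists_real_btwn.1 hay
  have hab : a < b := EReal.coe_lt_coe_iff.1 hab
  have hi := integrable_studentPDF hν
  have hsub : {t : ℝ | (t : EReal) ≤ x} ⊆ {t : ℝ | (t : EReal) ≤ y} :=
    fun t ht => le_trans ht hxy.le
  have hdiff : studentCDF ν y - studentCDF ν x =
      ∫ t in {t : ℝ | (t : EReal) ≤ y} \ {t : ℝ | (t : EReal) ≤ x}, studentPDF ν t := by
    rw [studentCDF, studentCDF, setIntegral_sdiff (measurableSet_coe_le x) hi.integrableOn hsub]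
  rw [← sub_pos, hdiff, setIntegral_pos_iff_support_of_nonneg_ae
    (Eventually.of_forall fun t => (studentPDF_pos hν t).le) hi.integrableOn]
  have : Function.support (studentPDF ν) = univ :=
    eq_univ_of_forall fun t => (studentPDF_pos hν t).ne'
  rw [this, univ_inter]
  have hIoc : Ioc a b ⊆ {t : ℝ | (t : EReal) ≤ y} \ {t : ℝ | (t : EReal) ≤ x} := by
    intro t ht
    refine ⟨(EReal.coe_le_coe_iff.2 ht.2).trans hby.le, fun h => ?_⟩
    exact absurd (hxa.trans (EReal.coe_lt_coe_iff.2 ht.1)) (not_lt.2 h)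
  refine lt_of_lt_of_le ?_ (measure_mono hIoc)
  simp [hab]

theorem studentCDF_nonneg {ν : ℝ} (hν : 0 < ν) (x : EReal) : 0 ≤ studentCDF ν x :=
  integral_nonneg fun x => (studentPDF_pos hν x).le

theorem exists_studentCDF_eq {ν : ℝ} (hν : 0 < ν) {u : ℝ} (hu : u ∈ Icc (0 : ℝ) 1) :
    ∃ x, studentCDF ν x = u := by
  have := isProbabilityMeasure_realLaw (lintegral_studentPDF hν)
  rcases eq_or_lt_of_le hu.1 with rfl | h0
  · exact ⟨⊥, studentCDF_bot ν⟩
  rcases eq_or_lt_of_le hu.2 with rfl | h1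
  · exact ⟨⊤, studentCDF_top hν⟩
  obtain ⟨z, hz⟩ := ((tendsto_cdf_atTop (realLaw (studentPDF ν))).eventually_const_lt h1).exists
  obtain ⟨w, hw⟩ := ((tendsto_cdf_atBot (realLaw (studentPDF ν))).eventually_lt_const h0).exists
  obtain ⟨y, hy⟩ := mem_range_of_exists_le_of_exists_ge
    (continuous_cdf_of_nullSingletonClass (realLaw (studentPDF ν))) ⟨w, hw.le⟩ ⟨z, hz.le⟩
  exact ⟨y, (studentCDF_coe hν y).trans hy⟩

theorem studentQuantile_studentCDF {ν : ℝ} (hν : 0 < ν) (x : EReal) :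
    studentQuantile ν (studentCDF ν x) = x := by
  simp only [studentQuantile, (strictMono_studentCDF hν).le_iff_le]
  exact csInf_Ici

/-- On `[0,1]` the quantile function is a true inverse, infinite endpoints included. For `u < 0` the
equivalence fails at `x = ⊥`. -/
theorem coe_le_studentQuantile_iff {ν : ℝ} (hν : 0 < ν) {u : ℝ} (hu : u ∈ Icc (0 : ℝ) 1)
    (x : EReal) : x ≤ studentQuantile ν u ↔ studentCDF ν x ≤ u := by
  obtain ⟨y, rfl⟩ := exists_studentCDF_eq hν hu
  rw [studentQuantile_studentCDF hν, (strictMono_studentCDF hν).le_iff_le]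

theorem monotone_studentQuantile (ν : ℝ) : Monotone (studentQuantile ν) :=
  fun _ _ h => sInf_le_sInf fun _ hx => h.trans hx

theorem measurable_studentQuantile_toReal (ν : ℝ) :
    Measurable fun u => (studentQuantile ν u).toReal :=
  (monotone_studentQuantile ν).measurable.ereal_toReal

/-- Turns the standardisation into a sum and a product, the form in which its measurability is
proved. -/
theorem EReal.sub_coe_div_coe (a : EReal) (m s : ℝ) :
    (a - (m : EReal)) / (s : EReal) = (a + ((-m : ℝ) : EReal)) * ((s⁻¹ : ℝ) : EReal) := by
  rw [EReal.coe_neg, EReal.coe_inv, sub_eq_add_neg]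
  rfl

theorem coe_le_iff_standardized (a : EReal) (m x : ℝ) {s : ℝ} (hs : 0 < s) :
    (x : EReal) ≤ a ↔ (((x - m) / s : ℝ) : EReal) ≤ (a - (m : EReal)) / (s : EReal) := by
  have hs' : (0 : EReal) < s := EReal.coe_pos.2 hs
  induction a with
  | bot => simp [EReal.bot_div_of_pos_ne_top hs' (EReal.coe_ne_top s)]
  | top => simp [EReal.top_div_of_pos_ne_top hs' (EReal.coe_ne_top s)]
  | coe a =>
    rw [← EReal.coe_sub, ← EReal.coe_div, EReal.coe_le_coe_iff, EReal.coe_le_coe_iff,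
      div_le_div_iff_of_pos_right hs, sub_le_sub_iff_right]

/-- The distribution function of the location-scale family of the Student distribution. -/
theorem lintegral_studentPDF_standardized {ν : ℝ} (hν : 0 < ν) (a : EReal) (m : ℝ) {s : ℝ}
    (hs : 0 < s) :
    ∫⁻ x in {x : ℝ | (x : EReal) ≤ a}, ENNReal.ofReal (s⁻¹ * studentPDF ν ((x - m) / s)) =
      ENNReal.ofReal (studentCDF ν ((a - (m : EReal)) / (s : EReal))) := by
  have hi := integrable_studentPDF hν
  set b : EReal := (a - (m : EReal)) / (s : EReal) with hb
  have hset : {x : ℝ | (x : EReal) ≤ a} = (fun x => (x - m) / s) ⁻¹' {t : ℝ | (t : EReal) ≤ b} :=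
    Set.ext fun x => coe_le_iff_standardized a m x hs
  have hint : Integrable fun x => s⁻¹ * studentPDF ν ((x - m) / s) :=
    (Integrable.comp_sub_right (hi.comp_div hs.ne') m).const_mul _
  rw [← ofReal_integral_eq_lintegral_ofReal hint.integrableOn (Eventually.of_forall fun x =>
    (mul_pos (inv_pos.2 hs) (studentPDF_pos hν _)).le)]
  congr 1
  rw [← integral_indicator (measurableSet_coe_le a), studentCDF,
    ← integral_indicator (measurableSet_coe_le b)]
  have : ∀ x, ({x : ℝ | (x : EReal) ≤ a}.indicator
      (fun x => s⁻¹ * studentPDF ν ((x - m) / s)) x) =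
      s⁻¹ * ({t : ℝ | (t : EReal) ≤ b}.indicator (studentPDF ν) ((x - m) / s)) := by
    intro x
    rw [hset]
    by_cases h : (((x - m) / s : ℝ) : EReal) ≤ b <;> simp [indicator, h]
  simp_rw [this]
  rw [integral_const_mul, integral_sub_right_eq_self
    (fun x => {t : ℝ | (t : EReal) ≤ b}.indicator (studentPDF ν) (x / s)),
    Measure.integral_comp_div, abs_of_pos hs, smul_eq_mul, inv_mul_cancel_left₀ hs.ne']

end Student
-- Bordered matrices and conditioning in the multivariate t-distribution
section Matrix

open Filter Topology

theorem measurableSet_pi_coe_le {κ : Type*} [Fintype κ] (c : κ → EReal) :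
    MeasurableSet {x : κ → ℝ | ∀ i, (x i : EReal) ≤ c i} := by
  simp only [ofPred_forall]
  exact MeasurableSet.iInter fun i =>
    (measurable_pi_apply i : Measurable fun x : κ → ℝ => x i) (measurableSet_coe_le (c i))

theorem continuous_quadraticForm {ι : Type*} [Fintype ι] (S : Matrix ι ι ℝ) :
    Continuous fun x : ι → ℝ => x ⬝ᵥ (S *ᵥ x) := by
  fun_prop

/-- The correlation matrix of a scalar and a vector with correlation matrix `S`, where `r` is the
vector of correlations between the scalar and the coordinates of the vector. -/
def borderedMatrix {ι : Type*} (r : ι → ℝ) (S : Matrix ι ι ℝ) : Matrix (Unit ⊕ ι) (Unit ⊕ ι) ℝ :=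
  Matrix.fromBlocks (Matrix.of fun _ _ => 1) (Matrix.of fun _ j => r j)
    (Matrix.of fun i _ => r i) S

theorem posDef_of_borderedMatrix {ι : Type*} {r : ι → ℝ} {S : Matrix ι ι ℝ}
    (h : (borderedMatrix r S).PosDef) : S.PosDef :=
  h.submatrix (e := Sum.inr) Sum.inr_injective

variable {ι : Type*} [Fintype ι] [DecidableEq ι]

theorem det_borderedMatrix {r : ι → ℝ} {S : Matrix ι ι ℝ} (hS : S.PosDef) :
    (borderedMatrix r S).det = S.det * (1 - r ⬝ᵥ (S⁻¹ *ᵥ r)) := by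
  have := hS.isUnit.invertible
  rw [borderedMatrix, Matrix.det_fromBlocks₂₂]
  congr 1
  rw [Matrix.det_unique, Matrix.sub_apply, Matrix.of_apply, Matrix.invOf_eq_nonsing_inv,
    Matrix.mul_assoc, Matrix.mul_apply]
  rfl

/-- The Schur complement is the quotient of two positive determinants. -/
theorem schur_pos_of_borderedMatrix {r : ι → ℝ} {S : Matrix ι ι ℝ}
    (h : (borderedMatrix r S).PosDef) : 0 < 1 - r ⬝ᵥ (S⁻¹ *ᵥ r) := by
  have hS := posDef_of_borderedMatrix h
  have hd := h.det_pos
  rw [det_borderedMatrix hS] at hd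
  exact (pos_iff_pos_of_mul_pos hd).1 hS.det_pos

/-- Block elimination: the lower block of the linear system gives the vector part in terms of the
scalar `a`, and substitution in the upper row determines `a`. The proof checks this solution by
applying the matrix to it. -/
theorem inv_mulVec_borderedMatrix {r : ι → ℝ} {S : Matrix ι ι ℝ}
    (h : (borderedMatrix r S).PosDef) (x₀ : ℝ) (x : ι → ℝ) :
    (borderedMatrix r S)⁻¹ *ᵥ Sum.elim (fun _ => x₀) x =
      Sum.elim (fun _ => (x₀ - r ⬝ᵥ (S⁻¹ *ᵥ x)) / (1 - r ⬝ᵥ (S⁻¹ *ᵥ r)))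
        (S⁻¹ *ᵥ (x - ((x₀ - r ⬝ᵥ (S⁻¹ *ᵥ x)) / (1 - r ⬝ᵥ (S⁻¹ *ᵥ r))) • r)) := by
  have hS := posDef_of_borderedMatrix h
  have hs := schur_pos_of_borderedMatrix h
  set s := 1 - r ⬝ᵥ (S⁻¹ *ᵥ r) with hsdef
  set a := (x₀ - r ⬝ᵥ (S⁻¹ *ᵥ x)) / s with ha
  have key : borderedMatrix r S *ᵥ Sum.elim (fun _ => a) (S⁻¹ *ᵥ (x - a • r)) =
      Sum.elim (fun _ => x₀) x := by
    rw [borderedMatrix, Matrix.fromBlocks_mulVec]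
    congr 1
    · funext u
      have : a * s = x₀ - r ⬝ᵥ (S⁻¹ *ᵥ x) := div_mul_cancel₀ _ hs.ne'
      have e : (Matrix.of fun (_ : Unit) j => r j) *ᵥ (S⁻¹ *ᵥ (x - a • r)) =
          fun _ => r ⬝ᵥ (S⁻¹ *ᵥ (x - a • r)) := rfl
      simp only [Pi.add_apply, Sum.elim_comp_inl, Sum.elim_comp_inr, e]
      simp only [Matrix.mulVec_sub, Matrix.mulVec_smul, dotProduct_sub, dotProduct_smul, smul_eq_mul]
      simp only [Matrix.mulVec, dotProduct, Matrix.of_apply, Finset.univ_unique,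
        Finset.sum_singleton] at this hsdef ⊢
      rw [hsdef] at this
      linarith
    · funext i
      have := hS.isUnit.invertible
      simp only [Sum.elim_comp_inl, Sum.elim_comp_inr, Matrix.mulVec_mulVec, Pi.add_apply,
        Matrix.mul_inv_of_invertible, Matrix.one_mulVec, Pi.sub_apply, Pi.smul_apply, smul_eq_mul]
      simp [Matrix.mulVec, dotProduct, mul_comm]
  rw [← key, Matrix.mulVec_mulVec, Matrix.nonsing_inv_mul _
    ((Matrix.isUnit_iff_isUnit_det _).1 h.isUnit), Matrix.one_mulVec]

/-- Completing the square; symmetry of `S⁻¹` merges the two cross terms into the residual `x₀ - r ⬝ᵥ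
(S⁻¹ *ᵥ x)`. -/
theorem quadraticForm_borderedMatrix {r : ι → ℝ} {S : Matrix ι ι ℝ}
    (h : (borderedMatrix r S).PosDef) (x₀ : ℝ) (x : ι → ℝ) :
    Sum.elim (fun _ => x₀) x ⬝ᵥ ((borderedMatrix r S)⁻¹ *ᵥ Sum.elim (fun _ => x₀) x) =
      x ⬝ᵥ (S⁻¹ *ᵥ x) + (x₀ - r ⬝ᵥ (S⁻¹ *ᵥ x)) ^ 2 / (1 - r ⬝ᵥ (S⁻¹ *ᵥ r)) := by
  have hS := posDef_of_borderedMatrix h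
  have hsymm : x ⬝ᵥ (S⁻¹ *ᵥ r) = r ⬝ᵥ (S⁻¹ *ᵥ x) := by
    have ht : (S⁻¹)ᵀ = S⁻¹ := by
      have := hS.inv.isHermitian
      rwa [Matrix.IsHermitian, Matrix.conjTranspose_eq_transpose_of_trivial] at this
    rw [Matrix.dotProduct_mulVec, ← Matrix.mulVec_transpose, ht, dotProduct_comm]
  rw [inv_mulVec_borderedMatrix h, sumElim_dotProduct_sumElim]
  simp only [Matrix.mulVec_sub, Matrix.mulVec_smul, dotProduct_sub, dotProduct_smul, smul_eq_mul,
    hsymm]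
  simp only [dotProduct, Finset.univ_unique, Finset.sum_singleton]
  ring

theorem measurable_mvtPDF (ν : ℝ) (S : Matrix ι ι ℝ) : Measurable (mvtPDF ν S) := by
  unfold mvtPDF
  exact ((((continuous_quadraticForm _).measurable.div_const _).const_add _).pow_const _).const_mul _

theorem quadraticForm_inv_nonneg {S : Matrix ι ι ℝ} (hS : S.PosDef) (x : ι → ℝ) :
    0 ≤ x ⬝ᵥ (S⁻¹ *ᵥ x) := by
  simpa using hS.inv.posSemidef.dotProduct_mulVec_nonneg x

theorem mvtPDF_nonneg {ν : ℝ} (hν : 0 < ν) {S : Matrix ι ι ℝ} (hS : S.PosDef) (x : ι → ℝ) :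
    0 ≤ mvtPDF ν S x := by
  have := quadraticForm_inv_nonneg hS x
  unfold mvtPDF
  positivity

/-- The location of the conditional distribution of the first coordinate of `MVT(0, M, ν)`,
where `M` is a bordered matrix. -/
noncomputable def condLoc (r : ι → ℝ) (S : Matrix ι ι ℝ) (x : ι → ℝ) : ℝ := r ⬝ᵥ (S⁻¹ *ᵥ x)

/-- The scale of the conditional distribution of the first coordinate of `MVT(0, M, ν)`,
where `M` is a bordered matrix. -/
noncomputable def condScale (ν : ℝ) (r : ι → ℝ) (S : Matrix ι ι ℝ) (x : ι → ℝ) : ℝ :=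
  √(1 - r ⬝ᵥ (S⁻¹ *ᵥ r)) * √((ν + x ⬝ᵥ (S⁻¹ *ᵥ x)) / (ν + Fintype.card ι))

theorem condScale_pos {ν : ℝ} (hν : 0 < ν) {r : ι → ℝ} {S : Matrix ι ι ℝ}
    (h : (borderedMatrix r S).PosDef) (x : ι → ℝ) : 0 < condScale ν r S x := by
  have h1 := schur_pos_of_borderedMatrix h
  have h2 := quadraticForm_inv_nonneg (posDef_of_borderedMatrix h) x
  unfold condScale
  positivity

theorem mvtPDF_borderedMatrix {ν : ℝ} (hν : 0 < ν) {r : ι → ℝ} {S : Matrix ι ι ℝ}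
    (h : (borderedMatrix r S).PosDef) (x₀ : ℝ) (x : ι → ℝ) :
    mvtPDF ν (borderedMatrix r S) (Sum.elim (fun _ => x₀) x) =
      mvtPDF ν S x * ((condScale ν r S x)⁻¹ *
        studentPDF (ν + Fintype.card ι) ((x₀ - condLoc r S x) / condScale ν r S x)) := by
  have hS := posDef_of_borderedMatrix h
  have hs := schur_pos_of_borderedMatrix h
  have hQ := quadraticForm_inv_nonneg hS x
  have hd := hS.det_pos
  rw [mvtPDF, quadraticForm_borderedMatrix h, det_borderedMatrix hS, mvtPDF, studentPDF]
  rw [show r ⬝ᵥ (S⁻¹ *ᵥ x) = condLoc r S x from rfl, condScale]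
  set s := 1 - r ⬝ᵥ (S⁻¹ *ᵥ r)
  set Q := x ⬝ᵥ (S⁻¹ *ᵥ x)
  set m := x₀ - condLoc r S x
  simp only [Fintype.card_sum, Fintype.card_unit, Nat.cast_add, Nat.cast_one]
  set n : ℝ := (Fintype.card ι : ℝ) with hn
  have hn0 : 0 ≤ n := Nat.cast_nonneg _
  have hνn : 0 < ν + n := by positivity
  have hνQ : 0 < ν + Q := by positivity
  -- This identity dictates the scale: it holds because the squared scale is `s (ν + Q) / (ν + n)`.
  have hbase : 1 + (Q + m ^ 2 / s) / ν =
      (1 + Q / ν) * (1 + (m / (√s * √((ν + Q) / (ν + n)))) ^ 2 / (ν + n)) := by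
    rw [div_pow, mul_pow, Real.sq_sqrt hs.le, Real.sq_sqrt (by positivity)]
    field_simp
    ring
  have hA : 0 < 1 + Q / ν := by positivity
  have hB : 0 < 1 + (m / (√s * √((ν + Q) / (ν + n)))) ^ 2 / (ν + n) := by positivity
  rw [hbase, Real.mul_rpow hA.le hB.le]
  have e1 : -(1 + n + ν) / 2 = -(ν + n + 1) / 2 := by ring
  have e2 : (1 + n + ν) / 2 = (ν + n + 1) / 2 := by ring
  have e3 : (n + ν) / 2 = (ν + n) / 2 := by ring
  -- The joint exponent exceeds the marginal one by a half in absolute value; the spare square root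
  -- becomes the factor `√(ν + Q)` of the inverse scale.
  have e4 : (1 + Q / ν) ^ (-(n + ν) / 2) = (1 + Q / ν) ^ (-(1 + n + ν) / 2) * √(1 + Q / ν) := by
    rw [Real.sqrt_eq_rpow, ← Real.rpow_add hA]
    congr 1
    ring
  have e5 : (Real.pi * ν) ^ ((1 + n) / 2) = (Real.pi * ν) ^ (n / 2) * √(Real.pi * ν) := by
    rw [Real.sqrt_eq_rpow, ← Real.rpow_add (by positivity)]
    congr 1
    ring
  have e6 : √(1 + Q / ν) * √(Real.pi * ν) = √Real.pi * √(ν + Q) := by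
    rw [← Real.sqrt_mul hA.le, ← Real.sqrt_mul Real.pi_pos.le]
    congr 1
    field_simp
  rw [e4, e5, e1, e2, e3, Real.sqrt_mul hd.le, Real.sqrt_div hνQ.le,
    Real.sqrt_mul Real.pi_pos.le (ν + n)]
  have e7 : √(1 + Q / ν) = √Real.pi * √(ν + Q) / √(Real.pi * ν) := by
    rw [← e6]
    field_simp
  rw [e7]
  -- With the powers opaque, only a rational identity in square roots and Gamma values remains.
  generalize (1 + Q / ν) ^ (-(ν + n + 1) / 2) = a1
  generalize (1 + (m / (√s * √((ν + Q) / (ν + n)))) ^ 2 / (ν + n)) ^ (-(ν + n + 1) / 2) = a2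
  generalize (1 + (m / (√s * (√(ν + Q) / √(ν + n)))) ^ 2 / (ν + n)) ^ (-(ν + n + 1) / 2) = a3
  have g1 : Real.Gamma ((ν + n) / 2) ≠ 0 := by positivity
  have g2 : Real.Gamma (ν / 2) ≠ 0 := by positivity
  have g3 : (Real.pi * ν) ^ (n / 2) ≠ 0 := by positivity
  have g4 : √(Real.pi * ν) ≠ 0 := by positivity
  have g5 : √(ν + n) ≠ 0 := by positivity
  have g6 : √(ν + Q) ≠ 0 := by positivity
  field_simp

theorem lintegral_mvtPDF_borderedMatrix {ν : ℝ} (hν : 0 < ν) {r : ι → ℝ} {S : Matrix ι ι ℝ}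
    (h : (borderedMatrix r S).PosDef) (a : EReal) (x : ι → ℝ) :
    ∫⁻ x₀ in {x₀ : ℝ | (x₀ : EReal) ≤ a},
        ENNReal.ofReal (mvtPDF ν (borderedMatrix r S) (Sum.elim (fun _ => x₀) x)) =
      ENNReal.ofReal (mvtPDF ν S x * studentCDF (ν + Fintype.card ι)
        ((a - (condLoc r S x : EReal)) / (condScale ν r S x : EReal))) := by
  have h0 := mvtPDF_nonneg hν (posDef_of_borderedMatrix h) x
  have hν' : 0 < ν + Fintype.card ι := by positivity
  have hcont := continuous_studentPDF hν'
  simp_rw [mvtPDF_borderedMatrix hν h, ENNReal.ofReal_mul h0]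
  rw [lintegral_const_mul _ (by fun_prop),
    lintegral_studentPDF_standardized hν' a _ (condScale_pos hν h x)]

/-- The distribution function of `MVT(0, M, ν)` for a bordered matrix `M`, by conditioning on all
but the first coordinate. -/
theorem mvt_borderedMatrix {ν : ℝ} (hν : 0 < ν) {r : ι → ℝ} {S : Matrix ι ι ℝ}
    (h : (borderedMatrix r S).PosDef) (a : EReal) (b : ι → EReal) :
    mvt ν (borderedMatrix r S) {x | ∀ i, (x i : EReal) ≤ Sum.elim (fun _ => a) b i} =
      ∫⁻ x in {x : ι → ℝ | ∀ i, (x i : EReal) ≤ b i},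
        ENNReal.ofReal (mvtPDF ν S x * studentCDF (ν + Fintype.card ι)
          ((a - (condLoc r S x : EReal)) / (condScale ν r S x : EReal))) := by
  have e : MeasurePreserving (fun y : ℝ × (ι → ℝ) =>
      (Sum.elim (fun _ => y.1) y.2 : Unit ⊕ ι → ℝ)) := by
    have e1 := (volume_preserving_funUnique Unit ℝ).symm
    have e2 := (volume_measurePreserving_sumPiEquivProdPi (fun _ : Unit ⊕ ι => ℝ)).symm
    have := e2.comp (e1.prod (MeasurePreserving.id (volume : Measure (ι → ℝ))))
    have hcomp : (fun y : ℝ × (ι → ℝ) => (Sum.elim (fun _ => y.1) y.2 : Unit ⊕ ι → ℝ)) =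
        (MeasurableEquiv.sumPiEquivProdPi fun _ : Unit ⊕ ι => ℝ).symm ∘
          Prod.map (MeasurableEquiv.funUnique Unit ℝ).symm id := by
      funext y i
      cases i <;> rfl
    rw [hcomp]
    exact this
  have hf := (measurable_mvtPDF ν (borderedMatrix r S)).ennreal_ofReal
  rw [mvt, withDensity_apply _ (measurableSet_pi_coe_le _), ← e.map_eq,
    setLIntegral_map (measurableSet_pi_coe_le _) hf e.measurable]
  have hset : (fun y : ℝ × (ι → ℝ) => (Sum.elim (fun _ => y.1) y.2 : Unit ⊕ ι → ℝ)) ⁻¹'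
      {x | ∀ i, (x i : EReal) ≤ Sum.elim (fun _ => a) b i} =
      {x₀ : ℝ | (x₀ : EReal) ≤ a} ×ˢ {x : ι → ℝ | ∀ i, (x i : EReal) ≤ b i} := by
    ext y
    simp
  rw [hset, Measure.volume_eq_prod, ← Measure.prod_restrict]
  -- Tonelli with the frequency coordinate as the inner variable.
  refine (lintegral_prod_symm _ (hf.comp e.measurable).aemeasurable).trans ?_
  exact lintegral_congr fun x => lintegral_mvtPDF_borderedMatrix hν h a x

end Matrix
-- From scores to severities
section Copula

open Filter Topology

variable {ι : Type*} [Fintype ι]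

theorem map_pi_cdf (μ : Measure ℝ) [IsProbabilityMeasure μ] [NullSingletonClass μ] :
    (Measure.pi fun _ : ι => μ).map (fun x i => cdf μ (x i)) =
      Measure.pi fun _ : ι => (volume : Measure ℝ).restrict (Icc (0 : ℝ) 1) := by
  have hm : Measurable (cdf μ) := (monotone_cdf μ).measurable
  have := Measure.isProbabilityMeasure_map (μ := μ) hm.aemeasurable
  rw [Measure.pi_map_pi (f := fun _ : ι => cdf μ) fun _ => hm.aemeasurable, map_cdf_eq_uniform]

/-- Change of variables between two atomless distributions with the same copula. -/
theorem setLIntegral_pi_cdf (μ τ : Measure ℝ) [IsProbabilityMeasure μ] [NullSingletonClass μ]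
    [IsProbabilityMeasure τ] [NullSingletonClass τ] {K : (ι → ℝ) → ℝ≥0∞} (hK : Measurable K)
    (y : ι → ℝ) :
    ∫⁻ x in {x : ι → ℝ | ∀ i, cdf τ (x i) ≤ cdf μ (y i)}, K (fun i => cdf τ (x i))
        ∂(Measure.pi fun _ => τ) =
      ∫⁻ x in {x : ι → ℝ | ∀ i, x i ≤ y i}, K (fun i => cdf μ (x i))
        ∂(Measure.pi fun _ => μ) := by
  have hB : MeasurableSet {u : ι → ℝ | ∀ i, u i ≤ cdf μ (y i)} :=
    measurableSet_Iic (a := fun i => cdf μ (y i))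
  have hmeas : ∀ σ : Measure ℝ, Measurable fun (x : ι → ℝ) i => cdf σ (x i) := fun σ =>
    measurable_pi_lambda _ fun i => (monotone_cdf σ).measurable.comp (measurable_pi_apply i)
  -- The box in the cube pulls back to a set that may exceed the orthant where the cdf is flat; the
  -- excess is null.
  have hswap : {x : ι → ℝ | ∀ i, x i ≤ y i} =ᵐ[Measure.pi fun _ => μ]
      {x : ι → ℝ | ∀ i, cdf μ (x i) ≤ cdf μ (y i)} := by
    have h : ∀ i, ∀ᵐ x ∂(Measure.pi fun _ : ι => μ), cdf μ (x i) ≤ cdf μ (y i) ↔ x i ≤ y i :=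
      fun i => (Measure.quasiMeasurePreserving_eval (fun _ : ι => μ) i).ae
        (cdf_preimage_Iic_ae_eq μ (y i)).mem_iff
    filter_upwards [ae_all_iff.2 h] with x hx
    exact propext (forall_congr' fun i => (hx i).symm)
  have h1 := setLIntegral_map (μ := Measure.pi fun _ : ι => τ) hB hK (hmeas τ)
  have h2 := setLIntegral_map (μ := Measure.pi fun _ : ι => μ) hB hK (hmeas μ)
  rw [setLIntegral_congr hswap]
  rw [map_pi_cdf] at h1 h2
  exact h1.symm.trans h2

theorem cdf_severity {f₂ : ℝ → ℝ} (hf : IsSeverityDensity f₂) (y : ℝ) :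
    cdf (realLaw f₂) y = severityCDF f₂ y :=
  cdf_realLaw hf.measurable hf.nonneg hf.lintegral_eq_one y

theorem severityCDF_mem_Icc {f₂ : ℝ → ℝ} (hf : IsSeverityDensity f₂) (y : ℝ) :
    severityCDF f₂ y ∈ Icc (0 : ℝ) 1 := by
  rw [← cdf_severity hf]
  exact ⟨cdf_nonneg _ _, cdf_le_one _ _⟩

theorem measurable_severityCDF {f₂ : ℝ → ℝ} (hf : IsSeverityDensity f₂) :
    Measurable (severityCDF f₂) := by
  rw [← funext (cdf_severity hf)]
  exact (monotone_cdf _).measurable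

/-- Dividing `G` by the product of Student densities turns the left side into an integral against
the product Student law, which transfers to the product severity law. Infinite scores, which
`toReal` sends to `0`, need `F₂ ∈ {0, 1}` in some coordinate, a null event under the latter. -/
theorem setLIntegral_scores {ν : ℝ} (hν : 0 < ν) {f₂ : ℝ → ℝ} (hf : IsSeverityDensity f₂) {k : ℕ}
    {G : (Fin k → ℝ) → ℝ} (hG : Measurable G) (y : Fin k → ℝ) :
    ∫⁻ x in {x : Fin k → ℝ | ∀ i, (x i : EReal) ≤ studentQuantile ν (severityCDF f₂ (y i))},
        ENNReal.ofReal (G x) =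
      ∫⁻ x in {x : Fin k → ℝ | ∀ i, x i ≤ y i}, ENNReal.ofReal
        (G (scores ν f₂ x) / (∏ i, studentPDF ν (scores ν f₂ x i)) * ∏ i, f₂ (x i)) := by
  have hφ := (continuous_studentPDF hν).measurable
  have hφ0 := studentPDF_pos hν
  have hφi := integrable_studentPDF hν
  have hfi := integrable_of_lintegral_ofReal_eq_one hf.measurable hf.nonneg hf.lintegral_eq_one
  have := isProbabilityMeasure_realLaw (lintegral_studentPDF hν)
  have := isProbabilityMeasure_realLaw hf.lintegral_eq_one
  have hprod0 : ∀ x : Fin k → ℝ, 0 < ∏ i, studentPDF ν (x i) := fun x =>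
    Finset.prod_pos fun i _ => hφ0 _
  have hprod : Measurable fun x : Fin k → ℝ => ∏ i, studentPDF ν (x i) :=
    Finset.measurable_prod _ fun i _ => hφ.comp (measurable_pi_apply i)
  have hfprod : Measurable fun x : Fin k → ℝ => ∏ i, f₂ (x i) :=
    Finset.measurable_prod _ fun i _ => hf.measurable.comp (measurable_pi_apply i)
  have hH : Measurable fun x : Fin k → ℝ => G x / ∏ i, studentPDF ν (x i) := hG.div hprod
  have hQ : Measurable fun (u : Fin k → ℝ) i => (studentQuantile ν (u i)).toReal :=
    measurable_pi_lambda _ fun i =>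
      (measurable_studentQuantile_toReal ν).comp (measurable_pi_apply i)
  have hF : Measurable fun (x : Fin k → ℝ) i => severityCDF f₂ (x i) :=
    measurable_pi_lambda _ fun i => (measurable_severityCDF hf).comp (measurable_pi_apply i)
  have hHF : Measurable fun x : Fin k → ℝ =>
      G (fun i => (studentQuantile ν (severityCDF f₂ (x i))).toReal) /
        ∏ i, studentPDF ν (studentQuantile ν (severityCDF f₂ (x i))).toReal :=
    hH.comp (hQ.comp hF)
  have hy : MeasurableSet {x : Fin k → ℝ | ∀ i, x i ≤ y i} := measurableSet_Iic (a := y)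
  have key := setLIntegral_pi_cdf (ι := Fin k) (realLaw f₂) (realLaw (studentPDF ν))
    (K := fun u => ENNReal.ofReal (G (fun i => (studentQuantile ν (u i)).toReal) /
      ∏ i, studentPDF ν (studentQuantile ν (u i)).toReal)) (hH.comp hQ).ennreal_ofReal y
  simp only [← studentCDF_coe hν, studentQuantile_studentCDF hν, EReal.toReal_coe,
    cdf_severity hf] at key
  rw [pi_withDensity_ofReal hφi fun x => (hφ0 x).le, pi_withDensity_ofReal hfi hf.nonneg,
    setLIntegral_withDensity_eq_setLIntegral_mul _ hprod.ennreal_ofReal hH.ennreal_ofReal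
      (by simpa only [← coe_le_studentQuantile_iff hν (severityCDF_mem_Icc hf _)] using
        measurableSet_pi_coe_le fun i => studentQuantile ν (severityCDF f₂ (y i))),
    setLIntegral_withDensity_eq_setLIntegral_mul _ hfprod.ennreal_ofReal
      hHF.ennreal_ofReal hy] at key
  simp only [← coe_le_studentQuantile_iff hν (severityCDF_mem_Icc hf _)] at key
  refine Eq.trans ?_ (key.trans ?_)
  · refine lintegral_congr fun x => ?_
    rw [Pi.mul_apply, ← ENNReal.ofReal_mul (hprod0 x).le, mul_div_cancel₀ _ (hprod0 x).ne']
  · refine lintegral_congr fun x => ?_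
    rw [Pi.mul_apply, ← ENNReal.ofReal_mul (Finset.prod_nonneg fun i _ => hf.nonneg _), mul_comm]
    rfl

/-- The density of `P(N⁺ ≤ n, Y ∈ ·)`, where `a` is the score of `n`. -/
noncomputable def cumDensity (z : CorrType) (ν ρ₁ ρ₂ : ℝ) (f₂ : ℝ → ℝ) {k : ℕ} (a : EReal)
    (y : Fin k → ℝ) : ℝ :=
  sevDensity z ν ρ₂ f₂ y * studentCDF (ν + k)
    ((a - (muStar z ν ρ₁ ρ₂ f₂ y : EReal)) / (sigmaStar z ν ρ₁ ρ₂ f₂ y : EReal))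

theorem measurable_scores (ν : ℝ) {f₂ : ℝ → ℝ} (hf : IsSeverityDensity f₂) (k : ℕ) :
    Measurable (scores ν f₂ (k := k)) :=
  measurable_pi_lambda _ fun i => ((measurable_studentQuantile_toReal ν).comp
    (measurable_severityCDF hf)).comp (measurable_pi_apply i)

theorem measurable_conditional_studentCDF {ν κ : ℝ} (hκ : 0 < κ) {ι : Type*} [Fintype ι]
    [DecidableEq ι] (r : ι → ℝ) (S : Matrix ι ι ℝ) (a : EReal) :
    Measurable fun x => studentCDF κ
      ((a - (condLoc r S x : EReal)) / (condScale ν r S x : EReal)) := by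
  have h1 : Measurable (condLoc r S) := by
    have : Continuous fun x : ι → ℝ => r ⬝ᵥ (S⁻¹ *ᵥ x) := by fun_prop
    exact this.measurable
  have h2 : Measurable (condScale ν r S) :=
    (((continuous_quadraticForm S⁻¹).measurable.const_add ν).div_const _).sqrt.const_mul _
  simp_rw [EReal.sub_coe_div_coe]
  exact (strictMono_studentCDF hκ).monotone.measurable.comp
    ((measurable_const.add h1.neg.coe_real_ereal).mul h2.inv.coe_real_ereal)

/-- The shape delivered by `setLIntegral_scores`: a function of the scores over the product of
Student densities, times the severity densities. -/
theorem cumDensity_eq (z : CorrType) (ν ρ₁ ρ₂ : ℝ) (f₂ : ℝ → ℝ) {k : ℕ} (a : EReal)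
    (y : Fin k → ℝ) :
    cumDensity z ν ρ₁ ρ₂ f₂ a y =
      mvtPDF ν (sevCorr z ρ₂ k) (scores ν f₂ y) * studentCDF (ν + Fintype.card (Fin k))
        ((a - (condLoc (fun _ => ρ₁) (sevCorr z ρ₂ k) (scores ν f₂ y) : EReal)) /
          (condScale ν (fun _ => ρ₁) (sevCorr z ρ₂ k) (scores ν f₂ y) : EReal)) /
        (∏ i, studentPDF ν (scores ν f₂ y i)) * ∏ i, f₂ (y i) := by
  have hs : sigmaStar z ν ρ₁ ρ₂ f₂ y =
      condScale ν (fun _ => ρ₁) (sevCorr z ρ₂ k) (scores ν f₂ y) := by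
    rw [sigmaStar, sigma, condScale, Fintype.card_fin]
  have hd : sevDensity z ν ρ₂ f₂ y = mvtPDF ν (sevCorr z ρ₂ k) (scores ν f₂ y) /
      (∏ i, studentPDF ν (scores ν f₂ y i)) * ∏ i, f₂ (y i) := rfl
  rw [cumDensity, hs, hd, Fintype.card_fin,
    show muStar z ν ρ₁ ρ₂ f₂ y = condLoc (fun _ => ρ₁) (sevCorr z ρ₂ k) (scores ν f₂ y) from rfl]
  ring

theorem measurable_cumDensity (z : CorrType) {ν : ℝ} (hν : 0 < ν) (ρ₁ ρ₂ : ℝ) {f₂ : ℝ → ℝ}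
    (hf : IsSeverityDensity f₂) (k : ℕ) (a : EReal) :
    Measurable (cumDensity z ν ρ₁ ρ₂ f₂ a (k := k)) := by
  have hκ : 0 < ν + Fintype.card (Fin k) := by positivity
  have hsc := measurable_scores ν hf k
  have hφ := (continuous_studentPDF hν).measurable
  have hprod : Measurable fun x : Fin k → ℝ => ∏ i, studentPDF ν (x i) :=
    Finset.measurable_prod _ fun i _ => hφ.comp (measurable_pi_apply i)
  have hfprod : Measurable fun x : Fin k → ℝ => ∏ i, f₂ (x i) :=
    Finset.measurable_prod _ fun i _ => hf.measurable.comp (measurable_pi_apply i)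
  rw [funext (cumDensity_eq z ν ρ₁ ρ₂ f₂ a)]
  exact ((((measurable_mvtPDF ν _).mul (measurable_conditional_studentCDF hκ _ _ a)).div
    hprod).comp hsc).mul hfprod

theorem sevDensity_nonneg {z : CorrType} {ν ρ₂ : ℝ} (hν : 0 < ν) {f₂ : ℝ → ℝ}
    (hf : IsSeverityDensity f₂) {k : ℕ} (hS : (sevCorr z ρ₂ k).PosDef) (y : Fin k → ℝ) :
    0 ≤ sevDensity z ν ρ₂ f₂ y :=
  mul_nonneg (div_nonneg (mvtPDF_nonneg hν hS _)
    (Finset.prod_nonneg fun _ _ => (studentPDF_pos hν _).le))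
    (Finset.prod_nonneg fun _ _ => hf.nonneg _)

theorem tCopula_jointCorr {z : CorrType} {ν ρ₁ ρ₂ : ℝ} (hν : 0 < ν) {f₂ : ℝ → ℝ}
    (hf : IsSeverityDensity f₂) {k : ℕ} (h : (jointCorr z ρ₁ ρ₂ k).PosDef) (u : ℝ)
    (y : Fin k → ℝ) :
    tCopula ν (jointCorr z ρ₁ ρ₂ k) (Sum.elim (fun _ => u) fun j => severityCDF f₂ (y j)) =
      ∫⁻ x in {x : Fin k → ℝ | ∀ i, x i ≤ y i},
        ENNReal.ofReal (cumDensity z ν ρ₁ ρ₂ f₂ (studentQuantile ν u) x) := by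
  have hκ : 0 < ν + Fintype.card (Fin k) := by positivity
  have h' : (borderedMatrix (fun _ => ρ₁) (sevCorr z ρ₂ k)).PosDef := h
  have hset : ∀ x : Unit ⊕ Fin k → ℝ, (∀ i, (x i : EReal) ≤ studentQuantile ν
      (Sum.elim (fun _ => u) (fun j => severityCDF f₂ (y j)) i)) ↔
      ∀ i, (x i : EReal) ≤ Sum.elim (fun _ => studentQuantile ν u)
        (fun j => studentQuantile ν (severityCDF f₂ (y j))) i := by
    intro x
    simp
  simp only [tCopula, hset]
  refine (mvt_borderedMatrix hν h' _ _).trans ?_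
  refine (setLIntegral_scores hν hf ((measurable_mvtPDF ν _).mul
    (measurable_conditional_studentCDF hκ _ _ _)) y).trans ?_
  refine lintegral_congr fun x => ?_
  rw [cumDensity_eq]
  rfl

end Copula
-- The collective risk model and the law of the observation
section Model

open Filter Topology

/-- The quadratic form is a sum of three nonnegative terms, with coefficients `1`, `ρ₂ - ρ₁²` and `1
- ρ₂`. The last is positive unless the severity part `v` vanishes, and then the first equals `a²`.
-/
theorem jointCorr_equi_posDef {ρ₁ ρ₂ : ℝ} (h : ParamRange .equi ρ₁ ρ₂) (k : ℕ) :
    (jointCorr .equi ρ₁ ρ₂ k).PosDef := by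
  obtain ⟨-, ⟨-, hρ⟩, hlt⟩ := h
  have hlt : ρ₁ ^ 2 < ρ₂ := hlt
  refine Matrix.PosDef.of_dotProduct_mulVec_pos ?_ fun x hx => ?_
  · rw [Matrix.IsHermitian, Matrix.conjTranspose_eq_transpose_of_trivial, jointCorr,
      Matrix.fromBlocks_transpose]
    congr 1
    ext i j
    simp [sevCorr, eq_comm]
  · have hsev : ∀ v : Fin k → ℝ, sevCorr .equi ρ₂ k *ᵥ v =
        fun i => (1 - ρ₂) * v i + ρ₂ * ∑ j, v j := by
      intro v
      funext i
      have : ∀ j, (if i = j then (1 : ℝ) else ρ₂) * v j =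
          (if i = j then (1 - ρ₂) * v j else 0) + ρ₂ * v j := by
        intro j
        split_ifs <;> ring
      simp only [sevCorr, Matrix.mulVec, dotProduct, Matrix.of_apply, this,
        Finset.sum_add_distrib, Finset.sum_ite_eq, Finset.mem_univ, if_true, Finset.mul_sum]
    set a := x (Sum.inl ()) with ha
    set v : Fin k → ℝ := fun j => x (Sum.inr j) with hv
    have hx' : x = Sum.elim (fun _ => a) v := by
      funext i
      rcases i with i | i <;> rfl
    have hform : star x ⬝ᵥ (jointCorr .equi ρ₁ ρ₂ k *ᵥ x) =
        (a + ρ₁ * ∑ j, v j) ^ 2 + (ρ₂ - ρ₁ ^ 2) * (∑ j, v j) ^ 2 + (1 - ρ₂) * ∑ j, v j ^ 2 := by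
      rw [star_trivial, hx', jointCorr, Matrix.fromBlocks_mulVec, sumElim_dotProduct_sumElim]
      simp only [Sum.elim_comp_inl, Sum.elim_comp_inr, hsev]
      simp only [Matrix.mulVec, dotProduct, Matrix.of_apply, Pi.add_apply, Finset.univ_unique,
        Finset.sum_singleton, mul_add, Finset.sum_add_distrib, ← Finset.mul_sum, ← Finset.sum_mul]
      have : ∑ j, v j * ((1 - ρ₂) * v j) = (1 - ρ₂) * ∑ j, v j ^ 2 := by
        rw [Finset.mul_sum]
        exact Finset.sum_congr rfl fun j _ => by ring
      rw [this]
      ring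
    rw [hform]
    have h1 : 0 ≤ (ρ₂ - ρ₁ ^ 2) * (∑ j, v j) ^ 2 := mul_nonneg (by linarith) (sq_nonneg _)
    have h2 : 0 ≤ ∑ j, v j ^ 2 := Finset.sum_nonneg fun j _ => sq_nonneg _
    by_cases hv0 : v = 0
    · have ha0 : a ≠ 0 := by
        rintro ha0
        apply hx
        rw [hx', hv0, ha0]
        funext i
        rcases i with i | i <;> rfl
      have : 0 < a ^ 2 := by positivity
      simpa [hv0] using this
    · have h3 : 0 < ∑ j, v j ^ 2 := by
        obtain ⟨j, hj⟩ := Function.ne_iff.1 hv0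
        have hj : v j ≠ 0 := hj
        exact Finset.sum_pos' (fun j _ => sq_nonneg _) ⟨j, Finset.mem_univ j, by positivity⟩
      have h4 : 0 < (1 - ρ₂) * ∑ j, v j ^ 2 := mul_pos (by linarith) h3
      have h5 := sq_nonneg (a + ρ₁ * ∑ j, v j)
      linarith

theorem observation_preimage {Ω : Type*} (R : Ω → Bool) (Nplus : Ω → ℕ) (Y : ℕ → Ω → ℝ)
    (s : Set (Σ n : ℕ, Fin n → ℝ)) :
    observation R Nplus Y ⁻¹' s = ⋃ n : ℕ,
      {ω | freq R Nplus ω = n ∧ (fun j : Fin n => Y j ω) ∈ Sigma.mk n ⁻¹' s} := by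
  ext ω
  simp only [mem_iUnion, mem_ofPred_eq, exists_eq_left', mem_preimage, observation]

variable {Ω : Type*} [MeasurableSpace Ω] {P : Measure Ω}
  {z : CorrType} {ν ρ₁ ρ₂ p : ℝ} {f₂ : ℝ → ℝ} {Nplus : Ω → ℕ} {Y : ℕ → Ω → ℝ} {R : Ω → Bool}

theorem freqCDF_mono (P : Measure Ω) [IsProbabilityMeasure P] (Nplus : Ω → ℕ) :
    Monotone (freqCDF P Nplus) :=
  fun _ _ hmn => measureReal_mono fun _ hω => le_trans hω hmn

theorem measurable_severities (h : TCopulaModel P z ν ρ₁ ρ₂ f₂ Nplus Y) (k : ℕ) :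
    Measurable fun ω => fun j : Fin k => Y j ω :=
  measurable_pi_lambda _ fun j => h.measurable_sev j

theorem measure_freq_le_inter [IsProbabilityMeasure P]
    (h : TCopulaModel P z ν ρ₁ ρ₂ f₂ Nplus Y) {k : ℕ} (hk : 0 < k)
    (hpd : (jointCorr z ρ₁ ρ₂ k).PosDef) (n : ℕ) {A : Set (Fin k → ℝ)} (hA : MeasurableSet A) :
    P {ω | Nplus ω ≤ n ∧ (fun j : Fin k => Y j ω) ∈ A} =
      ∫⁻ y in A, ENNReal.ofReal
        (cumDensity z ν ρ₁ ρ₂ f₂ (studentQuantile ν (freqCDF P Nplus n)) y) := by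
  have hY := measurable_severities h k
  have hN : MeasurableSet {ω | Nplus ω ≤ n} := h.measurable_freq measurableSet_Iic
  have happ : ∀ B : Set (Fin k → ℝ), MeasurableSet B →
      (P.restrict {ω | Nplus ω ≤ n}).map (fun ω => fun j : Fin k => Y j ω) B =
        P {ω | Nplus ω ≤ n ∧ (fun j : Fin k => Y j ω) ∈ B} := by
    intro B hB
    rw [Measure.map_apply hY hB, Measure.restrict_apply (hY hB), inter_comm]
    rfl
  have hlaw : (P.restrict {ω | Nplus ω ≤ n}).map (fun ω => fun j : Fin k => Y j ω) =
      volume.withDensity fun y => ENNReal.ofReal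
        (cumDensity z ν ρ₁ ρ₂ f₂ (studentQuantile ν (freqCDF P Nplus n)) y) := by
    refine measure_pi_ext_of_Iic fun y => ?_
    have hy : MeasurableSet {x : Fin k → ℝ | ∀ i, x i ≤ y i} := measurableSet_Iic (a := y)
    rw [happ _ hy, withDensity_apply _ hy, ← tCopula_jointCorr h.df_pos h.severity hpd]
    exact h.joint_cdf k hk hpd n y
  rw [← happ A hA, hlaw, withDensity_apply _ hA]

theorem condDensity_eq (n : ℕ) {k : ℕ} (y : Fin k → ℝ) :
    condDensity P z ν ρ₁ ρ₂ f₂ Nplus n y =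
      cumDensity z ν ρ₁ ρ₂ f₂ (studentQuantile ν (freqCDF P Nplus n)) y -
        cumDensity z ν ρ₁ ρ₂ f₂ (studentQuantile ν (freqCDF P Nplus (n - 1))) y := by
  rw [condDensity, mul_sub]
  rfl

/-- Makes the increments `condDensity` nonnegative, so that `ENNReal.ofReal` is additive on them. -/
theorem cumDensity_mono (hν : 0 < ν) (hf : IsSeverityDensity f₂) {k : ℕ}
    (hpd : (jointCorr z ρ₁ ρ₂ k).PosDef) (y : Fin k → ℝ) :
    Monotone fun a => cumDensity z ν ρ₁ ρ₂ f₂ a y := by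
  intro a b hab
  refine mul_le_mul_of_nonneg_left ((strictMono_studentCDF (by positivity)).monotone ?_)
    (sevDensity_nonneg hν hf (posDef_of_borderedMatrix hpd) y)
  refine EReal.div_le_div_right_of_nonneg ?_ (EReal.sub_le_sub hab le_rfl)
  exact EReal.coe_nonneg.2 (mul_nonneg (Real.sqrt_nonneg _) (Real.sqrt_nonneg _))

theorem cumDensity_nonneg (hν : 0 < ν) (hf : IsSeverityDensity f₂) {k : ℕ}
    (hpd : (jointCorr z ρ₁ ρ₂ k).PosDef) (a : EReal) (y : Fin k → ℝ) :
    0 ≤ cumDensity z ν ρ₁ ρ₂ f₂ a y :=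
  mul_nonneg (sevDensity_nonneg hν hf (posDef_of_borderedMatrix hpd) y)
    (studentCDF_nonneg (by positivity) _)

/-- The joint density of `(N⁺, Y_1, …, Y_k)`. -/
theorem measure_freq_eq_inter [IsProbabilityMeasure P]
    (h : TCopulaModel P z ν ρ₁ ρ₂ f₂ Nplus Y) {k : ℕ} (hk : 0 < k)
    (hpd : (jointCorr z ρ₁ ρ₂ k).PosDef) {n : ℕ} (hn : 0 < n) {A : Set (Fin k → ℝ)}
    (hA : MeasurableSet A) :
    P {ω | Nplus ω = n ∧ (fun j : Fin k => Y j ω) ∈ A} =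
      ∫⁻ y in A, ENNReal.ofReal (condDensity P z ν ρ₁ ρ₂ f₂ Nplus n y) := by
  have hν := h.df_pos
  have hf := h.severity
  have hY := measurable_severities h k
  -- Since `n > 0`, the truncated `n - 1` is the true predecessor; this also makes the union
  -- disjoint.
  have hsplit : {ω | Nplus ω ≤ n ∧ (fun j : Fin k => Y j ω) ∈ A} =
      {ω | Nplus ω ≤ n - 1 ∧ (fun j : Fin k => Y j ω) ∈ A} ∪
        {ω | Nplus ω = n ∧ (fun j : Fin k => Y j ω) ∈ A} := by
    ext ω
    have : Nplus ω ≤ n ↔ Nplus ω ≤ n - 1 ∨ Nplus ω = n := by omega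
    simp only [mem_ofPred_eq, mem_union, this]
    tauto
  have hdisj : Disjoint {ω | Nplus ω ≤ n - 1 ∧ (fun j : Fin k => Y j ω) ∈ A}
      {ω | Nplus ω = n ∧ (fun j : Fin k => Y j ω) ∈ A} := by
    refine disjoint_left.2 fun ω h1 h2 => ?_
    have h1 := h1.1
    have h2 := h2.1
    omega
  have hmeas : MeasurableSet {ω | Nplus ω = n ∧ (fun j : Fin k => Y j ω) ∈ A} :=
    (h.measurable_freq (measurableSet_singleton n)).inter (hY hA)
  have hP := congrArg P hsplit
  rw [measure_union hdisj hmeas, measure_freq_le_inter h hk hpd n hA] at hP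
  have hadd : ∀ y : Fin k → ℝ, ENNReal.ofReal
      (cumDensity z ν ρ₁ ρ₂ f₂ (studentQuantile ν (freqCDF P Nplus n)) y) =
      ENNReal.ofReal
        (cumDensity z ν ρ₁ ρ₂ f₂ (studentQuantile ν (freqCDF P Nplus (n - 1))) y) +
      ENNReal.ofReal (condDensity P z ν ρ₁ ρ₂ f₂ Nplus n y) := by
    intro y
    have hmono := cumDensity_mono hν hf hpd y
      (monotone_studentQuantile ν (freqCDF_mono P Nplus (Nat.sub_le n 1)))
    rw [condDensity_eq, ← ENNReal.ofReal_add (cumDensity_nonneg hν hf hpd _ y)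
      (sub_nonneg.2 hmono), add_sub_cancel]
  simp_rw [hadd] at hP
  rw [lintegral_add_left (measurable_cumDensity z hν ρ₁ ρ₂ hf k _).ennreal_ofReal,
    ← measure_freq_le_inter h hk hpd (n - 1) hA] at hP
  exact ((ENNReal.add_right_inj (measure_ne_top P _)).1 hP).symm

theorem measure_true_inter (hR : IsZeroIndicator P p R Nplus Y) {k : ℕ} (hk : 0 < k) (n : ℕ)
    {A : Set (Fin k → ℝ)} (hA : MeasurableSet A) :
    P {ω | R ω = true ∧ Nplus ω = n ∧ (fun j : Fin k => Y j ω) ∈ A} =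
      ENNReal.ofReal p * P {ω | Nplus ω = n ∧ (fun j : Fin k => Y j ω) ∈ A} := by
  have h := (hR.indep k hk).measure_inter_preimage_eq_mul {true} ({n} ×ˢ A)
    (measurableSet_singleton _) ((measurableSet_singleton n).prod hA)
  rw [← hR.prob_true]
  exact h

theorem measure_false [IsProbabilityMeasure P] (hR : IsZeroIndicator P p R Nplus Y) :
    P {ω | R ω = false} = ENNReal.ofReal (1 - p) := by
  have hset : {ω | R ω = false} = {ω | R ω = true}ᶜ := by
    ext ω
    simp
  have hm : MeasurableSet {ω | R ω = true} := hR.measurable (measurableSet_singleton true)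
  rw [hset, prob_compl_eq_one_sub hm, hR.prob_true, ENNReal.ofReal_sub _ hR.prob_mem.1,
    ENNReal.ofReal_one]

theorem measure_freq_observation [IsProbabilityMeasure P] (h : TCopulaModel P z ν ρ₁ ρ₂ f₂ Nplus Y)
    (hR : IsZeroIndicator P p R Nplus Y) {n : ℕ} (hpd : (jointCorr z ρ₁ ρ₂ n).PosDef)
    {A : Set (Fin n → ℝ)} (hA : MeasurableSet A) :
    P {ω | freq R Nplus ω = n ∧ (fun j : Fin n => Y j ω) ∈ A} =
      ∫⁻ y in A, ENNReal.ofReal (riskDensity P z ν ρ₁ ρ₂ f₂ Nplus p ⟨n, y⟩) := by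
  rcases Nat.eq_zero_or_pos n with rfl | hn
  · have hzero : ∀ ω, freq R Nplus ω = 0 ↔ R ω = false := by
      intro ω
      have := (h.freq_pos ω).ne'
      cases hRω : R ω <;> simp [freq, hRω, this]
    simp only [riskDensity, if_true, lintegral_const, Measure.restrict_apply_univ, hzero]
    -- A subset of the one-point space `ℝ⁰` is empty or everything, and the point has mass one.
    rcases Subsingleton.eq_empty_or_singleton (subsingleton_of_subsingleton (s := A)) with
      hA' | ⟨a, hA'⟩
    · simp [hA']
    · have hA' : A = univ := eq_univ_of_forall fun x => by
        rw [hA']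
        exact Subsingleton.elim x a
      have hvol : (volume : Measure (Fin 0 → ℝ)) univ = 1 := by
        rw [volume_pi, Measure.pi_univ]
        simp
      simp only [hA', mem_univ, and_true]
      rw [hvol, mul_one, measure_false hR]
  · have hset : {ω | freq R Nplus ω = n ∧ (fun j : Fin n => Y j ω) ∈ A} =
        {ω | R ω = true ∧ Nplus ω = n ∧ (fun j : Fin n => Y j ω) ∈ A} := by
      ext ω
      cases hRω : R ω <;> simp [freq, hRω, hn.ne]
    rw [hset, measure_true_inter hR hn n hA, measure_freq_eq_inter h hn hpd hn hA,
      ← lintegral_const_mul' _ _ ENNReal.ofReal_ne_top]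
    simp only [riskDensity, hn.ne', if_false, ENNReal.ofReal_mul hR.prob_mem.1]

/-- Without mass at `n`, `F₁⁺` has no jump there and the two Student terms cancel. Positive
definiteness is therefore not needed at such `n`. -/
theorem riskDensity_eq_zero [IsProbabilityMeasure P]
    {n : ℕ} (hn : 0 < n) (h0 : P {ω | Nplus ω = n} = 0)
    (y : Fin n → ℝ) : riskDensity P z ν ρ₁ ρ₂ f₂ Nplus p ⟨n, y⟩ = 0 := by
  have hF : freqCDF P Nplus n = freqCDF P Nplus (n - 1) := by
    refine le_antisymm ?_ (freqCDF_mono P Nplus (Nat.sub_le n 1))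
    have hsub : {ω | Nplus ω ≤ n} ⊆ {ω | Nplus ω ≤ n - 1} ∪ {ω | Nplus ω = n} := by
      intro ω hω
      have hω : Nplus ω ≤ n := hω
      have : Nplus ω ≤ n - 1 ∨ Nplus ω = n := by omega
      exact this
    have h0' : P.real {ω | Nplus ω = n} = 0 := by rw [Measure.real, h0, ENNReal.toReal_zero]
    calc P.real {ω | Nplus ω ≤ n} ≤ P.real ({ω | Nplus ω ≤ n - 1} ∪ {ω | Nplus ω = n}) :=
          measureReal_mono hsub
      _ ≤ P.real {ω | Nplus ω ≤ n - 1} + P.real {ω | Nplus ω = n} := measureReal_union_le _ _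
      _ = P.real {ω | Nplus ω ≤ n - 1} := by rw [h0', add_zero]
  simp only [riskDensity, hn.ne', if_false, condDensity_eq, hF, sub_self, mul_zero]

/-- The σ-algebra of the disjoint union is the infimum of those pushed forward from the summands. -/
theorem measurableSet_sigma_iff {β : ℕ → Type*} [∀ n, MeasurableSpace (β n)]
    {s : Set (Σ n, β n)} : MeasurableSet s ↔ ∀ n, MeasurableSet (Sigma.mk n ⁻¹' s) :=
  MeasurableSpace.measurableSet_iInf

theorem measurableEmbedding_sigmaMk {β : ℕ → Type*} [∀ n, MeasurableSpace (β n)] (n : ℕ) :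
    MeasurableEmbedding (Sigma.mk n : β n → Σ n, β n) where
  injective := sigma_mk_injective
  measurable := fun _ hs => measurableSet_sigma_iff.1 hs n
  measurableSet_image' := by
    intro s hs
    refine measurableSet_sigma_iff.2 fun m => ?_
    rcases eq_or_ne m n with rfl | hmn
    · rwa [preimage_image_eq _ sigma_mk_injective]
    · convert MeasurableSet.empty
      refine eq_empty_of_forall_notMem ?_
      rintro x ⟨y, -, hy⟩
      exact hmn (congrArg Sigma.fst hy).symm

theorem measurable_freq (h : TCopulaModel P z ν ρ₁ ρ₂ f₂ Nplus Y)
    (hR : IsZeroIndicator P p R Nplus Y) : Measurable (freq R Nplus) := by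
  unfold freq
  exact Measurable.ite (hR.measurable (measurableSet_singleton true)) h.measurable_freq
    measurable_const

theorem measurable_observation (h : TCopulaModel P z ν ρ₁ ρ₂ f₂ Nplus Y)
    (hR : IsZeroIndicator P p R Nplus Y) : Measurable (observation R Nplus Y) := by
  intro s hs
  rw [observation_preimage]
  exact MeasurableSet.iUnion fun n => (measurable_freq h hR (measurableSet_singleton n)).inter
    (measurable_severities h n (measurableSet_sigma_iff.1 hs n))

theorem setLIntegral_refMeasure (f : (Σ n : ℕ, Fin n → ℝ) → ℝ≥0∞)
    {s : Set (Σ n : ℕ, Fin n → ℝ)} (hs : MeasurableSet s) :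
    ∫⁻ x in s, f x ∂refMeasure = ∑' n : ℕ, ∫⁻ y in Sigma.mk n ⁻¹' s, f ⟨n, y⟩ := by
  rw [refMeasure, Measure.restrict_sum _ hs, lintegral_sum_measure]
  refine tsum_congr fun n => ?_
  rw [(measurableEmbedding_sigmaMk n).restrict_map, (measurableEmbedding_sigmaMk n).lintegral_map]

theorem map_observation [IsProbabilityMeasure P] (h : TCopulaModel P z ν ρ₁ ρ₂ f₂ Nplus Y)
    (hR : IsZeroIndicator P p R Nplus Y)
    -- The value `n = 0` is listed apart: `N⁺` never takes it, while `N` has mass `1 - p` there.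
    (hpd : ∀ n : ℕ, P {ω | Nplus ω = n} ≠ 0 ∨ n = 0 → (jointCorr z ρ₁ ρ₂ n).PosDef) :
    P.map (observation R Nplus Y) =
      refMeasure.withDensity fun x =>
        ENNReal.ofReal (riskDensity P z ν ρ₁ ρ₂ f₂ Nplus p x) := by
  ext s hs
  rw [Measure.map_apply (measurable_observation h hR) hs, observation_preimage, measure_iUnion,
    withDensity_apply _ hs, setLIntegral_refMeasure _ hs]
  · refine tsum_congr fun n => ?_
    by_cases hn : P {ω | Nplus ω = n} ≠ 0 ∨ n = 0
    · exact measure_freq_observation h hR (hpd n hn) (measurableSet_sigma_iff.1 hs n)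
    · obtain ⟨h0, hn⟩ := not_or.1 hn
      have h0 := not_not.1 h0
      simp only [riskDensity_eq_zero (Nat.pos_of_ne_zero hn) h0, ENNReal.ofReal_zero,
        lintegral_zero]
      refine measure_mono_null (fun ω hω => ?_) h0
      have hω := hω.1
      unfold freq at hω
      split_ifs at hω
      · exact hω
      · exact absurd hω.symm hn
  · intro m n hmn
    exact disjoint_left.2 fun ω h1 h2 => hmn (h1.1.symm.trans h2.1)
  · exact fun n => (measurable_freq h hR (measurableSet_singleton n)).inter
      (measurable_severities h n (measurableSet_sigma_iff.1 hs n))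

theorem jointCorr_zero_posDef (z : CorrType) (ρ₁ ρ₂ : ℝ) : (jointCorr z ρ₁ ρ₂ 0).PosDef := by
  have : jointCorr z ρ₁ ρ₂ 0 = 1 := by
    ext i j
    rcases i with i | i
    · rcases j with j | j
      · simp [jointCorr]
      · exact j.elim0
    · exact i.elim0
  rw [this]
  exact Matrix.PosDef.one

theorem jointCorr_posDef_of_autoreg (h : ParamRange z ρ₁ ρ₂) {n : ℕ}
    (hz : z = CorrType.autoreg → (jointCorr z ρ₁ ρ₂ n).PosDef) :
    (jointCorr z ρ₁ ρ₂ n).PosDef := by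
  cases z
  · exact jointCorr_equi_posDef h n
  · exact hz rfl

end Model

theorem theorem4 {Ω : Type*} [MeasurableSpace Ω] (P : Measure Ω) [IsProbabilityMeasure P]
    (z : CorrType) (ν ρ₁ ρ₂ p : ℝ) (f₂ : ℝ → ℝ)
    (Nplus : Ω → ℕ) (Y : ℕ → Ω → ℝ) (R : Ω → Bool)
    (hmodel : TCopulaModel P z ν ρ₁ ρ₂ f₂ Nplus Y)
    (hR : IsZeroIndicator P p R Nplus Y) :
    -- the density on the part `N = n` of the sample space
    (∀ n : ℕ, (z = CorrType.autoreg → (jointCorr z ρ₁ ρ₂ n).PosDef) →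
      ∀ A : Set (Fin n → ℝ), MeasurableSet A →
        P {ω | freq R Nplus ω = n ∧ (fun j : Fin n => Y j ω) ∈ A} =
          ∫⁻ y in A, ENNReal.ofReal (riskDensity P z ν ρ₁ ρ₂ f₂ Nplus p ⟨n, y⟩)) ∧
    -- the density of the whole law of `(N, Y^{[N]})`
    ((z = CorrType.autoreg →
        ∀ n : ℕ, P {ω | Nplus ω = n} ≠ 0 → (jointCorr z ρ₁ ρ₂ n).PosDef) →
      Measurable (observation R Nplus Y) ∧
        P.map (observation R Nplus Y) =
          refMeasure.withDensity fun x =>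
            ENNReal.ofReal (riskDensity P z ν ρ₁ ρ₂ f₂ Nplus p x)) := by
  refine ⟨fun n hz A hA => measure_freq_observation hmodel hR
    (jointCorr_posDef_of_autoreg hmodel.params hz) hA,
    fun hz => ⟨measurable_observation hmodel hR, map_observation hmodel hR fun n hn => ?_⟩⟩
  rcases hn with hn | rfl
  · exact jointCorr_posDef_of_autoreg hmodel.params fun hz' => hz hz' n hn
  · exact jointCorr_zero_posDef z ρ₁ ρ₂
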